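/- Let $\mathcal H$ be a complex Hilbert space (inner product antilinear in the first variable) and $H$ a self-adjoint operator on $\mathcal H$. Let $\mathcal H_{\rm ac},\mathcal H_{\rm sc}$ be the subspaces of vectors whose spectral measure with respect to $H$ is absolutely continuous, respectively singular and without atoms, let $\mathcal H_{\rm p}$ be the closed linear hull of the eigenvectors of $H$, and let $H_{\rm ac},H_{\rm sc},H_{\rm p}$ be the reduced parts of $H$. Assume that $H\in S_1(\mathcal H)$, that is: (H.1) $\sigma(H_{\rm sc})=\emptyset$; (H.2) $\sigma(H_{\rm ac})=[0,\infty)$; (H.3) $\sigma_{\rm disc}(H)=\sigma_{\rm p}(H)=\{E_n\}_{n=1}^\infty$ with $E_1<E_2<\cdots<0$ and $E_n\to0$, where $\sigma_{\rm p}(H)$ is the set of eigenvalues and $\sigma_{\rm disc}(H)$ the set of eigenvalues of finite multiplicity that are isolated points of $\sigma(H)$; (H.4) $H_{\rm ac}$ has a strong time operator, i.e. a densely defined symmetric operator $T$ on $\mathcal H_{\rm ac}$ with $e^{-itH_{\rm ac}}{\rm D}(T)\subset {\rm D}(T)$ and $Te^{-itH_{\rm ac}}\psi=e^{-itH_{\rm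 ac}}(T+t)\psi$ for all $\psi\in{\rm D}(T)$, $t\in\mathbb R$. A CCR-domain for $(H_{\rm ac},T)$ is a non-zero subspace of ${\rm D}(H_{\rm ac}T)\cap {\rm D}(TH_{\rm ac})$ on which $H_{\rm ac}T-TH_{\rm ac}=-i$. A sesquilinear form $\mathfrak t:\mathcal D_1\times\mathcal D_2\to\mathbb C$ on non-zero subspaces $\mathcal D_1,\mathcal D_2$ of $\mathcal H$ is an ultra-weak time operator of $H$, with ultra-weak CCR-domain $\mathscr E$, if $\mathscr E\neq\{0\}$ and there is a non-zero subspace $\mathcal D\subset\mathcal D_1\cap\mathcal D_2$ with $\mathscr E\subset {\rm D}(H)\cap\mathcal D$, $\mathfrak t[\phi,\psi]^*=\mathfrak t[\psi,\phi]$ for $\phi,\psi\in\mathcal D$, $H\mathscr E\subset\mathcal D_1$, and $\mathfrak t[H\phi,\psi]-\mathfrak t[H\psi,\phi]^*=-i(\phi,\psi)$ for $\phi,\psi\in\mathscr E$. Then the following hold. (a) $H_{\rm ac}$ has a closed strong time operator, and every closed strong time operator of $H_{\rm ac}$ has a CCR-domain that is dense in $\mathcal H_{\rm ac}$. (b) There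 are $N\le\infty$ and an orthonormal family $(e^j_n)_{j\le N,\,n\in\mathbb N}$ whose closed linear hull is $\mathcal H_{\rm p}$, with $He_n^j=F_{jn}e_n^j$, where for each $j$ the numbers $F_{jn}$ ($n\in\mathbb N$) are distinct and $\sum_nF_{jn}^2<\infty$. (c) Let $T_{\rm ac}$ be any strong time operator of $H_{\rm ac}$ that has a dense CCR-domain $\mathcal D_{\rm ac}$, and let $(e_n^j)$ be any family as in (b). Let $\mathcal H_j$ be the closed linear hull of $\{e_n^j\}_n$, $H_j$ the part of $H$ in $\mathcal H_j$, ${\rm D}(S_j)$ the linear hull of $\{e_n^j\}_n$, $$S_j\phi=i\sum_n\Big(\sum_{m\ne n}\frac{(e_m^j,\phi)}{1/F_{jn}-1/F_{jm}}\Big)e_n^j,\qquad \mathfrak t_j[\phi,\psi]=-\tfrac12\{(S_j\phi,H_j^{-2}\psi)+(H_j^{-2}\phi,S_j\psi)\}\qquad(\phi,\psi\in {\rm D}(S_j)),$$ let $\mathcal D_{\rm p}$ be the algebraic direct sum of the ${\rm D}(S_j)$, $\mathfrak t_{\rm p}[\phi,\psi]=\sum_j\mathfrak t_j[\phi_j,\psi_j]$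 on $\mathcal D_{\rm p}\times\mathcal D_{\rm p}$, and $\mathscr E_{\rm p}$ the linear hull of all $e^j_n-e^j_m$ ($j\le N$, $n,m\in\mathbb N$). Then the form $\mathfrak t_H:(\mathcal H_{\rm ac}\oplus\mathcal D_{\rm p})\times({\rm D}(T_{\rm ac})\oplus\mathcal D_{\rm p})\to\mathbb C$, $$\mathfrak t_H[\phi_1\oplus\phi_2,\psi_1\oplus\psi_2]=(\phi_1,T_{\rm ac}\psi_1)+\mathfrak t_{\rm p}[\phi_2,\psi_2],$$ is well defined and is an ultra-weak time operator of $H$; $\mathcal D_{\rm ac}\oplus H_{\rm p}^{-1}\mathscr E_{\rm p}$ is an ultra-weak CCR-domain for $(H,\mathfrak t_H)$, and $\mathcal D_{\rm ac}\oplus H_{\rm p}\mathscr E_{\rm p}$ is an ultra-weak CCR-domain for $(H,\mathfrak t_H)$ that is dense in $\mathcal H$. -/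

import Mathlib

open MeasureTheory
open scoped ComplexConjugate

noncomputable section

namespace TimeOperator

/-! ### Unbounded operators: value, spectrum, eigenvalues, reduced parts -/

section Operators

variable {E : Type*} [NormedAddCommGroup E] [InnerProductSpace ℂ E]

open scoped Classical in
/-- The value `A x` of an operator at a vector of its domain, and `0` outside the domain. -/
def value (A : E →ₗ.[ℂ] E) (x : E) : E :=
  if h : x ∈ A.domain then A ⟨x, h⟩ else 0

/-- The resolvent set: all `z` for which `A - z : D(A) → E` is a bijection with bounded inverse. -/
def resolventSet (A : E →ₗ.[ℂ] E) : Set ℂ :=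
  {z | ∃ R : E →L[ℂ] E,
    (∀ x : E, ∃ h : R x ∈ A.domain, A ⟨R x, h⟩ - z • R x = x) ∧
    ∀ x : A.domain, R (A x - z • (x : E)) = x}

/-- The spectrum `σ(A)`. -/
def spectrum (A : E →ₗ.[ℂ] E) : Set ℂ := (resolventSet A)ᶜ

/-- The eigenspace `ker (A - z)`, as a subspace of `E`. -/
def eigenspace (A : E →ₗ.[ℂ] E) (z : ℂ) : Submodule ℂ E :=
  (LinearMap.ker (A.toFun - z • A.domain.subtype)).map A.domain.subtype

/-- The set `σ_p(A)` of all eigenvalues. -/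
def pointSpectrum (A : E →ₗ.[ℂ] E) : Set ℂ := {z | eigenspace A z ≠ ⊥}

/-- The discrete spectrum `σ_disc(A)`: the eigenvalues of finite multiplicity that are isolated
points of the spectrum. -/
def discreteSpectrum (A : E →ₗ.[ℂ] E) : Set ℂ :=
  {z | z ∈ pointSpectrum A ∧ FiniteDimensional ℂ (eigenspace A z) ∧
    ∃ ε > 0, spectrum A ∩ Metric.ball z ε ⊆ {z}}

/-- The part of `A` in the subspace `K`, as an operator on the space `K`, with domain
`{x ∈ K ∩ D(A) | A x ∈ K}`.  If `K` reduces `A`, this is the reduced part of `A` to `K`. -/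
def reducedPart (A : E →ₗ.[ℂ] E) (K : Submodule ℂ E) : K →ₗ.[ℂ] K where
  domain :=
    { carrier := {x | ∃ h : (x : E) ∈ A.domain, A ⟨x, h⟩ ∈ K}
      zero_mem' := ⟨A.domain.zero_mem, by
        have : A ⟨0, A.domain.zero_mem⟩ = 0 := A.map_zero
        simp [this]⟩
      add_mem' := by
        rintro x y ⟨hx, hx'⟩ ⟨hy, hy'⟩
        refine ⟨A.domain.add_mem hx hy, ?_⟩
        have : A ⟨(x : E) + y, A.domain.add_mem hx hy⟩ = A ⟨x, hx⟩ + A ⟨y, hy⟩ :=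
          A.map_add ⟨x, hx⟩ ⟨y, hy⟩
        exact this ▸ K.add_mem hx' hy'
      smul_mem' := by
        rintro c x ⟨hx, hx'⟩
        refine ⟨A.domain.smul_mem c hx, ?_⟩
        have : A ⟨c • (x : E), A.domain.smul_mem c hx⟩ = c • A ⟨x, hx⟩ :=
          A.map_smul c ⟨x, hx⟩
        exact this ▸ K.smul_mem c hx' }
  toFun :=
    { toFun := fun x => ⟨A ⟨x.1, x.2.choose⟩, x.2.choose_spec⟩
      map_add' := fun x y =>
        Subtype.ext (A.map_add ⟨x.1, x.2.choose⟩ ⟨y.1, y.2.choose⟩)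
      map_smul' := fun c x => Subtype.ext (A.map_smul c ⟨x.1, x.2.choose⟩) }

end Operators

/-! ### Spectral subspaces of a self-adjoint operator -/

section Spectral

variable {E : Type*} [NormedAddCommGroup E] [InnerProductSpace ℂ E]

/-- `μ` is the spectral measure `μ_ψ = (ψ, E_A(·)ψ)` of the vector `ψ` with respect to the
self-adjoint operator `A`: the (unique) finite Borel measure on the line with
`(ψ, (A - z)⁻¹ψ) = ∫ (λ - z)⁻¹ dμ(λ)` for all non-real `z`.
Here `φ = (A - z)⁻¹ψ` is the unique vector of `D(A)` with `(A - z)φ = ψ`. -/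
def IsSpectralMeasure (A : E →ₗ.[ℂ] E) (ψ : E) (μ : Measure ℝ) : Prop :=
  IsFiniteMeasure μ ∧
    ∀ z : ℂ, z.im ≠ 0 → ∃ φ : A.domain, A φ - z • (φ : E) = ψ ∧
      inner ℂ ψ (φ : E) = ∫ l : ℝ, ((l : ℂ) - z)⁻¹ ∂μ

/-- The subspace of absolute continuity: the vectors whose spectral measure is absolutely continuous
with respect to Lebesgue measure.  (For self-adjoint `A` these vectors already form a closed
subspace; the same applies to the next definition.) -/
def acSubspace (A : E →ₗ.[ℂ] E) : Submodule ℂ E :=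
  (Submodule.span ℂ {ψ | ∃ μ : Measure ℝ, IsSpectralMeasure A ψ μ ∧ μ ≪ volume}).topologicalClosure

/-- The subspace of singular continuity: the vectors whose spectral measure has no atoms and is
singular with respect to Lebesgue measure. -/
def scSubspace (A : E →ₗ.[ℂ] E) : Submodule ℂ E :=
  (Submodule.span ℂ {ψ | ∃ μ : Measure ℝ, IsSpectralMeasure A ψ μ ∧ (∀ x, μ {x} = 0) ∧
    μ ⟂ₘ volume}).topologicalClosure

/-- The subspace of discontinuity: the closed linear hull of all eigenvectors. -/
def ppSubspace (A : E →ₗ.[ℂ] E) : Submodule ℂ E :=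
  (⨆ z : ℂ, eigenspace A z).topologicalClosure

instance [CompleteSpace E] (A : E →ₗ.[ℂ] E) : CompleteSpace (acSubspace A) :=
  inferInstanceAs (CompleteSpace (Submodule.topologicalClosure _))

instance [CompleteSpace E] (A : E →ₗ.[ℂ] E) : CompleteSpace (ppSubspace A) :=
  inferInstanceAs (CompleteSpace (Submodule.topologicalClosure _))

/-- The absolutely continuous part `A_ac`. -/
abbrev acPart (A : E →ₗ.[ℂ] E) : acSubspace A →ₗ.[ℂ] acSubspace A := reducedPart A (acSubspace A)

/-- The singular continuous part `A_sc`. -/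
abbrev scPart (A : E →ₗ.[ℂ] E) : scSubspace A →ₗ.[ℂ] scSubspace A := reducedPart A (scSubspace A)

end Spectral

/-! ### Time operators -/

section Time

variable {E : Type*} [NormedAddCommGroup E] [InnerProductSpace ℂ E]

/-- A symmetric operator: densely defined and contained in its adjoint. -/
def IsSymmetricOp (T : E →ₗ.[ℂ] E) : Prop :=
  Dense (T.domain : Set E) ∧ T.IsFormalAdjoint T

/-- `U t = e^{-itA}`: `U` is the strongly continuous one-parameter unitary group whose
generator is `-iA`. -/
structure IsUnitaryGroup (A : E →ₗ.[ℂ] E) (U : ℝ → E →L[ℂ] E) : Prop where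
  map_zero : U 0 = 1
  map_add : ∀ s t, U (s + t) = U s * U t
  norm_map : ∀ t ψ, ‖U t ψ‖ = ‖ψ‖
  continuous : ∀ ψ, Continuous fun t => U t ψ
  generator : ∀ ψ η : E, (∃ h : ψ ∈ A.domain, A ⟨ψ, h⟩ = η) ↔
    HasDerivAt (fun t => U t ψ) (-(Complex.I • η)) 0

/-- `T` is a strong time operator of the self-adjoint operator `A`: `T` is symmetric,
`e^{-itA} D(T) ⊆ D(T)` and `T e^{-itA} ψ = e^{-itA} (T + t) ψ` for `ψ ∈ D(T)`, `t ∈ ℝ`. -/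
def IsStrongTimeOperator [CompleteSpace E] (A T : E →ₗ.[ℂ] E) : Prop :=
  IsSelfAdjoint A ∧ IsSymmetricOp T ∧ ∃ U : ℝ → E →L[ℂ] E, IsUnitaryGroup A U ∧
    ∀ (t : ℝ) (ψ : T.domain), ∃ h : U t ψ ∈ T.domain,
      T ⟨U t ψ, h⟩ = U t (T ψ + (t : ℂ) • (ψ : E))

/-- `D` is a CCR-domain for the pair `(A, B)`: a non-zero subspace of `D(AB) ∩ D(BA)` on which
`AB - BA = -i`. -/
def IsCCRDomain (A B : E →ₗ.[ℂ] E) (D : Submodule ℂ E) : Prop :=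
  D ≠ ⊥ ∧ ∀ ψ ∈ D, ∃ (hA : ψ ∈ A.domain) (hB : ψ ∈ B.domain)
    (hAB : B ⟨ψ, hB⟩ ∈ A.domain) (hBA : A ⟨ψ, hA⟩ ∈ B.domain),
    A ⟨B ⟨ψ, hB⟩, hAB⟩ - B ⟨A ⟨ψ, hA⟩, hBA⟩ = -(Complex.I • ψ)

/-- Antilinear in the first and linear in the second variable. -/
structure IsSesquilinear {D₁ D₂ : Submodule ℂ E} (t : D₁ → D₂ → ℂ) : Prop where
  add_left : ∀ φ φ' ψ, t (φ + φ') ψ = t φ ψ + t φ' ψ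
  smul_left : ∀ (c : ℂ) φ ψ, t (c • φ) ψ = conj c * t φ ψ
  add_right : ∀ φ ψ ψ', t φ (ψ + ψ') = t φ ψ + t φ ψ'
  smul_right : ∀ (c : ℂ) φ ψ, t φ (c • ψ) = c * t φ ψ

/-- `𝓔` is an ultra-weak CCR-domain for `(H, t)`, with symmetric domain `D`. -/
structure IsUltraWeakCCRDomainWith (H : E →ₗ.[ℂ] E) {D₁ D₂ : Submodule ℂ E} (t : D₁ → D₂ → ℂ)
    (D 𝓔 : Submodule ℂ E) : Prop where
  ne_bot : 𝓔 ≠ ⊥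
  symm_ne_bot : D ≠ ⊥
  symm_le_left : D ≤ D₁
  symm_le_right : D ≤ D₂
  le_symm : 𝓔 ≤ D
  le_domain : 𝓔 ≤ H.domain
  symm : ∀ φ ψ (hφ : φ ∈ D) (hψ : ψ ∈ D),
    conj (t ⟨φ, symm_le_left hφ⟩ ⟨ψ, symm_le_right hψ⟩) =
      t ⟨ψ, symm_le_left hψ⟩ ⟨φ, symm_le_right hφ⟩
  map_mem : ∀ φ (hφ : φ ∈ 𝓔), H ⟨φ, le_domain hφ⟩ ∈ D₁
  ccr : ∀ φ ψ (hφ : φ ∈ 𝓔) (hψ : ψ ∈ 𝓔),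
    t ⟨H ⟨φ, le_domain hφ⟩, map_mem φ hφ⟩ ⟨ψ, symm_le_right (le_symm hψ)⟩ -
      conj (t ⟨H ⟨ψ, le_domain hψ⟩, map_mem ψ hψ⟩ ⟨φ, symm_le_right (le_symm hφ)⟩) =
      -(Complex.I * inner ℂ φ ψ)

/-- `𝓔` is an ultra-weak CCR-domain for `(H, t)`. -/
def IsUltraWeakCCRDomain (H : E →ₗ.[ℂ] E) {D₁ D₂ : Submodule ℂ E} (t : D₁ → D₂ → ℂ)
    (𝓔 : Submodule ℂ E) : Prop :=
  ∃ D : Submodule ℂ E, IsUltraWeakCCRDomainWith H t D 𝓔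

/-- The form `t : D₁ × D₂ → ℂ` is an ultra-weak time operator of `H`. -/
def IsUltraWeakTimeOperator (H : E →ₗ.[ℂ] E) {D₁ D₂ : Submodule ℂ E} (t : D₁ → D₂ → ℂ) : Prop :=
  D₁ ≠ ⊥ ∧ D₂ ≠ ⊥ ∧ IsSesquilinear t ∧ ∃ 𝓔 : Submodule ℂ E, IsUltraWeakCCRDomain H t 𝓔

/-- The class `S₁`. -/
structure ClassS1 [CompleteSpace E] (H : E →ₗ.[ℂ] E) : Prop where
  selfAdjoint : IsSelfAdjoint H
  sc_empty : spectrum (scPart H) = ∅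
  ac_eq : spectrum (acPart H) = (fun x : ℝ => (x : ℂ)) '' Set.Ici 0
  disc_eq : discreteSpectrum H = pointSpectrum H
  point_eq : ∃ e : ℕ → ℝ, pointSpectrum H = Set.range (fun n => (e n : ℂ)) ∧ StrictMono e ∧
    (∀ n, e n < 0) ∧ Filter.Tendsto e Filter.atTop (nhds 0)
  exists_time : ∃ T : acSubspace H →ₗ.[ℂ] acSubspace H, IsStrongTimeOperator (acPart H) T

end Time

/-! ### The form on the point part -/

section PointPart

variable {E : Type*} [NormedAddCommGroup E] [InnerProductSpace ℂ E]

/-- An orthogonal decomposition `𝓗_p(H) = ⊕_{j < N} 𝓗_j` (`N ≤ ∞`), where `𝓗_j` is the closed linear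
hull of the orthonormal eigenvectors `vec j 0, vec j 1, …`, the corresponding eigenvalues
`val j 0, val j 1, …` of `H` being mutually distinct (so that they are simple eigenvalues of the
part of `H` in `𝓗_j`) and square summable. -/
structure EigenDecomposition (H : E →ₗ.[ℂ] E) where
  N : ℕ∞
  vec : {j : ℕ // (j : ℕ∞) < N} → ℕ → E
  val : {j : ℕ // (j : ℕ∞) < N} → ℕ → ℝ
  orthonormal : Orthonormal ℂ (fun p : {j : ℕ // (j : ℕ∞) < N} × ℕ => vec p.1 p.2)
  eigen : ∀ j n, vec j n ∈ eigenspace H (val j n)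
  injective : ∀ j, Function.Injective (val j)
  summable : ∀ j, Summable fun n => val j n ^ 2
  span_eq : (Submodule.span ℂ (Set.range
    (fun p : {j : ℕ // (j : ℕ∞) < N} × ℕ => vec p.1 p.2))).topologicalClosure = ppSubspace H

namespace EigenDecomposition

variable {H : E →ₗ.[ℂ] E} (d : EigenDecomposition H)

/-- The index set `{j | j < N}`. -/
abbrev Idx : Type := {j : ℕ // (j : ℕ∞) < d.N}

/-- The domain `D(S_j)`, the linear hull of the `e_n^j`, `n ∈ ℕ`. -/
def domS (j : d.Idx) : Submodule ℂ E := Submodule.span ℂ (Set.range (d.vec j))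

/-- The closed subspace `𝓗_j`. -/
def space (j : d.Idx) : Submodule ℂ E := (d.domS j).topologicalClosure

instance [CompleteSpace E] (j : d.Idx) : CompleteSpace (d.space j) :=
  inferInstanceAs (CompleteSpace (Submodule.topologicalClosure _))

/-- The operator `S_j`, with domain `D(S_j)`:
`S_j φ = i ∑_n (∑_{m ≠ n} (e_m, φ) / (1 / F_n - 1 / F_m)) e_n`.
For `φ` in `D(S_j)` the inner sum is finite and the outer one converges in norm. -/
def opS (j : d.Idx) (φ : E) : E :=
  Complex.I • ∑' n, (∑' m, if m = n then 0 else
    inner ℂ (d.vec j m) φ / (1 / (d.val j n : ℂ) - 1 / (d.val j m : ℂ))) • d.vec j n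

/-- `H⁻² ψ` (`0` outside the domain of `H⁻²`).  For injective `H` the inverse of the part of `H`
in `𝓗_j` is the restriction of `H⁻¹`, so that on `D(S_j)` this is `H_j⁻² ψ`. -/
def invSq (H : E →ₗ.[ℂ] E) (ψ : E) : E := value H.inverse (value H.inverse ψ)

/-- `t_j[φ, ψ] = -((S_j φ, H_j⁻² ψ) + (H_j⁻² φ, S_j ψ)) / 2` for `φ, ψ ∈ D(S_j)`. -/
def formJ (j : d.Idx) (φ ψ : E) : ℂ :=
  -(1 / 2) * (inner ℂ (d.opS j φ) (invSq H ψ) + inner ℂ (invSq H φ) (d.opS j ψ))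

/-- The domain `D_p = ⊕_j D(S_j)` (algebraic direct sum). -/
def domP : Submodule ℂ E := ⨆ j, d.domS j

/-- `t_p[φ, ψ] = ∑_j t_j[φ_j, ψ_j]` for `φ, ψ ∈ D_p`, with `φ_j` the component of `φ` in `𝓗_j`; only
finitely many components are non-zero. -/
def formP [CompleteSpace E] (φ ψ : E) : ℂ :=
  ∑ᶠ j, d.formJ j ((d.space j).starProjection φ) ((d.space j).starProjection ψ)

/-- `𝓔_p = ⊕_j 𝓔_j` (algebraic direct sum) with `𝓔_j` the linear hull of all `e_n^j - e_m^j`. -/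
def ccrP : Submodule ℂ E :=
  ⨆ j, Submodule.span ℂ {x | ∃ n m, x = d.vec j n - d.vec j m}

/-- `H_p⁻¹ 𝓔_p`, the set of all `φ ∈ D(H)` in `𝓗_p(H)` with `H φ ∈ 𝓔_p`. -/
def invCcrP : Submodule ℂ E :=
  (d.ccrP.comap H.toFun).map H.domain.subtype ⊓ ppSubspace H

/-- `H_p 𝓔_p`, the image of `𝓔_p` under `H`. -/
def mapCcrP : Submodule ℂ E := (d.ccrP.comap H.domain.subtype).map H.toFun

end EigenDecomposition

/-! ### The form `t_H` -/

variable {H : E →ₗ.[ℂ] E}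

/-- The direct sum `A ⊕ B` of a subspace `A` of `𝓗_ac(H)` and a subspace `B` of `𝓗_p(H)`. -/
def dirSum (A : Submodule ℂ (acSubspace H)) (B : Submodule ℂ E) : Submodule ℂ E :=
  A.map (acSubspace H).subtype ⊔ B

/-- The form `t_H` on `(𝓗_ac(H) ⊕ D_p) × (D(T) ⊕ D_p)`,
`t_H[φ₁ ⊕ φ₂, ψ₁ ⊕ ψ₂] = (φ₁, T ψ₁) + t_p[φ₂, ψ₂]`, the components being obtained by orthogonal
projection. -/
def formH [CompleteSpace E] (T : acSubspace H →ₗ.[ℂ] acSubspace H) (d : EigenDecomposition H)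
    (φ : dirSum (⊤ : Submodule ℂ (acSubspace H)) d.domP) (ψ : dirSum T.domain d.domP) : ℂ :=
  inner ℂ ((acSubspace H).orthogonalProjectionOnto (φ : E))
      (value T ((acSubspace H).orthogonalProjectionOnto (ψ : E))) +
    d.formP ((ppSubspace H).starProjection (φ : E)) ((ppSubspace H).starProjection (ψ : E))

end PointPart

end TimeOperator

end

/-! The absolutely continuous and the point part are handled separately and then added, which is
possible because `𝓗 = 𝓗_ac ⊕ 𝓗_p` orthogonally. This decomposition comes from the spectral theorem
for a single vector, obtained from the continuous functional calculus of the normal operator `(H -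
i)⁻¹`: cutting the spectral measure of a vector along its atoms and a Lebesgue null set gives
`acSubspace_sup_scSubspace_sup_ppSubspace`. The singular continuous summand vanishes because a
symmetric operator with empty spectrum lives on the zero space. Orthogonality holds because a vector
whose spectral measure has no atom at `a` is orthogonal to the eigenvectors for `a`.

Absolutely continuous part: the strong time relation passes to closures. For closed `T` the smeared
vectors `∫ f(t) e^{itA}ψ dt`, with `f` smooth of compact support and `ψ ∈ D(T)`, form a dense set;
on them `A` acts as `f ↦ i f'` and `T` as `ψ ↦ Tψ` minus multiplication of `f` by `t`, so that the
Leibniz rule for `t f` is the commutation relation (`dense_ccrSubmodule`).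

Point part: a basis of eigenvectors is split into classes with distinct, square summable eigenvalues
(`exists_partition_summable_sq`). In this basis `t_p` is a Hermitian matrix, and its commutator with
`H` plus `i` times the identity has the entries `(i/2)(F_p/F_q + F_q/F_p)` within a class
(`bval_sub_mul_coeff`). Multiplied by the weights `F_p F_q` or `1/(F_p F_q)`, which is the effect of
applying `H_p` or `H_p⁻¹` to `𝓔_p`, such an entry becomes a sum `u_p + u_q`. A matrix of this shape
vanishes on coefficients whose sum over each class is zero (`matrixForm_zeroSum`), and the vectors
of `𝓔_p` have such coefficients. Density of `H_p 𝓔_p` follows from `F_n e_n - F_k e_k → F_n e_n`. -/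

noncomputable section

namespace TimeOperator

/-! ### Resolvents of self-adjoint operators at non-real points. -/

section SelfAdjoint

variable {E : Type*} [NormedAddCommGroup E] [InnerProductSpace ℂ E]

theorem mem_eigenspace_iff {A : E →ₗ.[ℂ] E} {z : ℂ} {x : E} :
    x ∈ eigenspace A z ↔ ∃ h : x ∈ A.domain, A ⟨x, h⟩ = z • x := by
  constructor
  · rintro ⟨⟨y, hy⟩, hy', rfl⟩
    refine ⟨hy, ?_⟩
    have : A.toFun ⟨y, hy⟩ - z • y = 0 := hy'
    exact sub_eq_zero.mp this
  · rintro ⟨h, hx⟩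
    refine ⟨⟨x, h⟩, ?_, rfl⟩
    change A.toFun ⟨x, h⟩ - z • x = 0
    exact sub_eq_zero.mpr hx

theorem value_of_mem {A : E →ₗ.[ℂ] E} {x : E} (h : x ∈ A.domain) : value A x = A ⟨x, h⟩ :=
  dif_pos h

theorem im_inner_apply_self {A : E →ₗ.[ℂ] E} (hA : A.IsFormalAdjoint A) (x : A.domain) :
    (inner ℂ (x : E) (A x)).im = 0 := by
  have h := hA x x
  rw [← inner_conj_symm] at h
  have := congrArg Complex.im h
  simp only [Complex.conj_im] at this
  linarith

theorem im_inner_apply_sub_smul {A : E →ₗ.[ℂ] E} (hA : A.IsFormalAdjoint A) (z : ℂ)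
    (x : A.domain) : (inner ℂ (x : E) (A x - z • (x : E))).im = -(z.im * ‖(x : E)‖ ^ 2) := by
  rw [inner_sub_right, inner_smul_right, inner_self_eq_norm_sq_to_K, Complex.sub_im,
    im_inner_apply_self hA]
  simp [← Complex.ofReal_pow]

/-- Cauchy–Schwarz applied to `(x, (A - z)x)`, whose imaginary part is `-Im z ‖x‖²`. Off the real
axis this lower bound gives injectivity and closed range of `A - z`. -/
theorem im_mul_norm_le {A : E →ₗ.[ℂ] E} (hA : A.IsFormalAdjoint A) (z : ℂ) (x : A.domain) :
    |z.im| * ‖(x : E)‖ ≤ ‖A x - z • (x : E)‖ := by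
  rcases eq_or_ne ‖(x : E)‖ 0 with h | h
  · rw [h, mul_zero]; exact norm_nonneg _
  have h1 : |z.im| * ‖(x : E)‖ ^ 2 ≤ ‖(x : E)‖ * ‖A x - z • (x : E)‖ := by
    calc |z.im| * ‖(x : E)‖ ^ 2 = |(inner ℂ (x : E) (A x - z • (x : E))).im| := by
          rw [im_inner_apply_sub_smul hA, abs_neg, abs_mul, abs_of_nonneg (sq_nonneg ‖(x : E)‖)]
      _ ≤ _ := (Complex.abs_im_le_norm _).trans (norm_inner_le_norm _ _)
  have h2 : 0 < ‖(x : E)‖ := lt_of_le_of_ne (norm_nonneg _) h.symm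
  nlinarith

variable [CompleteSpace E]

theorem isFormalAdjoint_of_isSelfAdjoint {A : E →ₗ.[ℂ] E} (hA : IsSelfAdjoint A) :
    A.IsFormalAdjoint A := by
  have h := LinearPMap.adjoint_isFormalAdjoint hA.dense_domain
  rwa [LinearPMap.isSelfAdjoint_def.mp hA] at h

/-- The inclusion `A* ⊆ A`, the half of self-adjointness that symmetry does not give. -/
theorem exists_apply_eq_of_isSelfAdjoint {A : E →ₗ.[ℂ] E} (hA : IsSelfAdjoint A) {y w : E}
    (h : ∀ x : A.domain, inner ℂ w (x : E) = inner ℂ y (A x)) :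
    ∃ hy : y ∈ A.domain, A ⟨y, hy⟩ = w := by
  have h1 : y ∈ A.adjoint.domain := LinearPMap.mem_adjoint_domain_of_exists _ ⟨w, h⟩
  have h2 := LinearPMap.adjoint_apply_eq hA.dense_domain ⟨y, h1⟩ h
  have h3 := LinearPMap.isSelfAdjoint_def.mp hA
  have h4 : (y, w) ∈ A.adjoint.graph := by
    rw [LinearPMap.mem_graph_iff]; exact ⟨⟨y, h1⟩, rfl, h2⟩
  rw [h3, LinearPMap.mem_graph_iff] at h4
  obtain ⟨⟨y', hy'⟩, rfl, h5⟩ := h4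
  exact ⟨hy', h5⟩

/-- Non-real numbers belong to the resolvent set of a self-adjoint operator. -/
theorem mem_resolventSet_of_im_ne_zero {A : E →ₗ.[ℂ] E} (hA : IsSelfAdjoint A) {z : ℂ}
    (hz : z.im ≠ 0) : z ∈ resolventSet A := by
  have hs := isFormalAdjoint_of_isSelfAdjoint hA
  have hz' : 0 < |z.im| := abs_pos.mpr hz
  have : CompleteSpace A.graph := (IsSelfAdjoint.isClosed hA).completeSpace_coe
  -- On the graph, a Banach space because `A` is closed, `A - z` is a bounded operator, and the
  -- bounded inverse theorem becomes available.
  let L : A.graph →L[ℂ] E :=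
    ((ContinuousLinearMap.snd ℂ E E) - z • (ContinuousLinearMap.fst ℂ E E)).comp A.graph.subtypeL
  have hL : ∀ p : A.graph, L p = (p : E × E).2 - z • (p : E × E).1 := fun p => rfl
  have hfst : ∀ p : A.graph, |z.im| * ‖(p : E × E).1‖ ≤ ‖L p‖ := by
    rintro ⟨⟨x, y⟩, hp⟩
    obtain ⟨x', rfl, rfl⟩ := LinearPMap.mem_graph_iff _ |>.mp hp
    exact im_mul_norm_le hs z x'
  have hanti : ∀ p : A.graph, ‖p‖ ≤ (1 + (1 + ‖z‖) / |z.im|) * ‖L p‖ := by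
    intro p
    have h1 : ‖(p : E × E).1‖ ≤ ‖L p‖ / |z.im| := by
      rw [le_div_iff₀ hz', mul_comm]; exact hfst p
    have h2 : ‖(p : E × E).2‖ ≤ ‖L p‖ + ‖z‖ * ‖(p : E × E).1‖ := by
      rw [← norm_smul, hL]
      exact (norm_le_norm_sub_add _ _)
    have h3 : ‖p‖ ≤ ‖(p : E × E).1‖ + ‖(p : E × E).2‖ := by
      rw [Submodule.coe_norm, Prod.norm_def]
      exact max_le_add_of_nonneg (norm_nonneg _) (norm_nonneg _)
    have h4 : (1 + (1 + ‖z‖) / |z.im|) * ‖L p‖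
        = ‖L p‖ / |z.im| + (‖L p‖ + ‖z‖ * (‖L p‖ / |z.im|)) := by ring
    rw [h4]
    have := mul_le_mul_of_nonneg_left h1 (norm_nonneg z)
    linarith
  have hpos : 0 ≤ 1 + (1 + ‖z‖) / |z.im| := by positivity
  have hal : AntilipschitzWith ⟨_, hpos⟩ L := L.antilipschitz_of_bound hanti
  have hker : LinearMap.ker (L : A.graph →ₗ[ℂ] E) = ⊥ := LinearMap.ker_eq_bot.mpr hal.injective
  have hcl : IsClosed (Set.range L) := hal.isClosed_range L.uniformContinuous
  -- A vector orthogonal to the range is an eigenvector of `A* = A` for `conj z`, or zero; the lower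
  -- bound leaves only zero.
  have horth : (LinearMap.range (L : A.graph →ₗ[ℂ] E))ᗮ = ⊥ := by
    rw [Submodule.eq_bot_iff]
    intro y hy
    have h1 : ∀ x : A.domain, inner ℂ (conj z • y) (x : E) = inner ℂ y (A x) := by
      intro x
      have h2 : inner ℂ y (A x - z • (x : E)) = 0 := by
        refine Submodule.inner_left_of_mem_orthogonal (K := LinearMap.range (L : A.graph →ₗ[ℂ] E))
          ?_ hy
        exact ⟨⟨(x, A x), LinearPMap.mem_graph _ x⟩, rfl⟩
      rw [inner_sub_right, inner_smul_right] at h2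
      rw [inner_smul_left, Complex.conj_conj]
      exact (sub_eq_zero.mp h2).symm
    obtain ⟨hy', h2⟩ := exists_apply_eq_of_isSelfAdjoint hA h1
    have h3 := im_mul_norm_le hs (conj z) ⟨y, hy'⟩
    rw [h2, sub_self, norm_zero, Complex.conj_im, abs_neg] at h3
    have h4 : ‖y‖ ≤ 0 := by
      by_contra! h
      exact absurd h3 (not_le.mpr (mul_pos hz' h))
    exact norm_le_zero_iff.mp h4
  have hrange : LinearMap.range (L : A.graph →ₗ[ℂ] E) = ⊤ := by
    have h1 := Submodule.topologicalClosure_eq_top_iff.mpr horth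
    rwa [IsClosed.submodule_topologicalClosure_eq] at h1
    exact hcl
  let e := ContinuousLinearEquiv.ofBijective L hker hrange
  have he : ∀ p, e p = L p := fun p => rfl
  refine ⟨(ContinuousLinearMap.fst ℂ E E).comp
    (A.graph.subtypeL.comp (e.symm : E →L[ℂ] A.graph)), ?_, ?_⟩
  · intro x
    obtain ⟨x', h1, h2⟩ := (LinearPMap.mem_graph_iff _).mp (e.symm x).2
    have h3 : L (e.symm x) = x := by rw [← he, ContinuousLinearEquiv.apply_symm_apply]
    rw [hL] at h3
    refine ⟨?_, ?_⟩
    · change ((e.symm x : A.graph) : E × E).1 ∈ A.domain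
      rw [← h1]; exact x'.2
    · conv_rhs => rw [← h3]
      congr 1
      rw [← h2]
      congr 1
      exact Subtype.ext h1.symm
  · intro x
    have : A x - z • (x : E) = e ⟨(x, A x), LinearPMap.mem_graph _ x⟩ := rfl
    rw [this]
    simp

end SelfAdjoint

/-! ### Empty spectra, and orthogonality of the absolutely continuous and the point subspace. -/

section Subspaces

variable {E : Type*} [NormedAddCommGroup E] [InnerProductSpace ℂ E]

theorem reducedPart_isFormalAdjoint {A : E →ₗ.[ℂ] E} (hA : A.IsFormalAdjoint A)
    (K : Submodule ℂ E) : (reducedPart A K).IsFormalAdjoint (reducedPart A K) := by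
  intro x y
  exact hA ⟨(x : K), x.2.choose⟩ ⟨(y : K), y.2.choose⟩

/-- A symmetric operator with empty spectrum lives on the zero space. -/
theorem subsingleton_of_spectrum_eq_empty [CompleteSpace E] {A : E →ₗ.[ℂ] E}
    (hA : A.IsFormalAdjoint A) (h : spectrum A = ∅) : Subsingleton E := by
  by_contra hE
  rw [not_subsingleton_iff_nontrivial] at hE
  have hres : ∀ z, z ∈ resolventSet A := fun z => by
    by_contra hz
    have : z ∈ spectrum A := hz
    rw [h] at this
    exact this
  obtain ⟨R, hR1, hR2⟩ := hres 0
  simp only [zero_smul, sub_zero] at hR1 hR2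
  have hsa : IsSelfAdjoint R := by
    rw [ContinuousLinearMap.isSelfAdjoint_iff_isSymmetric]
    intro x y
    obtain ⟨hx, hx'⟩ := hR1 x
    obtain ⟨hy, hy'⟩ := hR1 y
    have := hA ⟨R x, hx⟩ ⟨R y, hy⟩
    rw [hx', hy'] at this
    exact this.symm
  have hinj : ∀ x, R x = 0 → x = 0 := by
    intro x hx
    obtain ⟨h1, h2⟩ := hR1 x
    rw [← h2]
    have : (⟨R x, h1⟩ : A.domain) = 0 := Subtype.ext hx
    rw [this, LinearPMap.map_zero]
  have hR0 : R ≠ 0 := by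
    rintro rfl
    obtain ⟨x, hx⟩ := exists_ne (0 : E)
    exact hx (hinj x rfl)
  -- The bounded self-adjoint operator `R = A⁻¹` is non-zero, so it has a spectral value `l` of
  -- modulus `‖R‖ ≠ 0`. This contradicts `l⁻¹` lying in the resolvent set of `A`.
  have hrad := hsa.spectralRadius_eq_nnnorm
  obtain ⟨l, hl, hl'⟩ := _root_.spectrum.exists_nnnorm_eq_spectralRadius R
  have hl0 : l ≠ 0 := by
    rintro rfl
    rw [hrad] at hl'
    simp only [nnnorm_zero, ENNReal.coe_zero] at hl'
    exact hR0 (by simpa using hl'.symm)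
  obtain ⟨S, hS1, hS2⟩ := hres l⁻¹
  -- `R - l = l R (l⁻¹ - A)` is invertible
  have key1 : ∀ x, S (R x) = l • (S x - R x) := by
    intro x
    obtain ⟨h1, h2⟩ := hR1 x
    have h3 := hS2 ⟨R x, h1⟩
    rw [h2, map_sub, map_smul] at h3
    simp only at h3
    nth_rw 2 [← h3]
    rw [sub_sub_cancel, smul_smul, mul_inv_cancel₀ hl0, one_smul]
  have key2 : ∀ x, R (S x) = l • (S x - R x) := by
    intro x
    obtain ⟨h1, h2⟩ := hS1 x
    have h3 := hR2 ⟨S x, h1⟩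
    rw [sub_eq_iff_eq_add] at h2
    rw [h2, map_add, map_smul] at h3
    simp only at h3
    nth_rw 2 [← h3]
    rw [add_sub_cancel_left, smul_smul, mul_inv_cancel₀ hl0, one_smul]
  -- The inverse comes from the formal computation `(l - A⁻¹)⁻¹ = A / (lA - 1) = l⁻¹(1 + l⁻¹(A -
  -- l⁻¹)⁻¹)`.
  have hunit : IsUnit (algebraMap ℂ (E →L[ℂ] E) l - R) := by
    refine ⟨⟨algebraMap ℂ (E →L[ℂ] E) l - R,
      l⁻¹ • (1 + l⁻¹ • S), ?_, ?_⟩, rfl⟩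
    · ext x
      change l • (l⁻¹ • (x + l⁻¹ • S x)) - R (l⁻¹ • (x + l⁻¹ • S x)) = x
      rw [map_smul, map_add, map_smul, key2]
      match_scalars <;> field_simp <;> ring
    · ext x
      change l⁻¹ • ((l • x - R x) + l⁻¹ • S (l • x - R x)) = x
      rw [map_sub, map_smul, key1]
      match_scalars <;> field_simp <;> ring
  exact hl hunit

theorem scSubspace_eq_bot [CompleteSpace E] {A : E →ₗ.[ℂ] E} (hA : A.IsFormalAdjoint A)
    (h : spectrum (scPart A) = ∅) : scSubspace A = ⊥ := by
  have : CompleteSpace (scSubspace A) :=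
    inferInstanceAs (CompleteSpace (Submodule.topologicalClosure _))
  have := subsingleton_of_spectrum_eq_empty (reducedPart_isFormalAdjoint hA _) h
  exact Submodule.subsingleton_iff_eq_bot.mp this

theorem nontrivial_of_spectrum_nonempty {A : E →ₗ.[ℂ] E} (h : (spectrum A).Nonempty) :
    Nontrivial E := by
  by_contra hE
  rw [not_nontrivial_iff_subsingleton] at hE
  obtain ⟨z, hz⟩ := h
  refine hz ⟨0, fun x => ⟨?_, Subsingleton.elim _ _⟩, fun x => Subsingleton.elim _ _⟩
  rw [Subsingleton.elim ((0 : E →L[ℂ] E) x) 0]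
  exact A.domain.zero_mem

theorem eigenvalue_conj_eq {A : E →ₗ.[ℂ] E} (hA : A.IsFormalAdjoint A) {z : ℂ} {x : E}
    (hx : x ∈ eigenspace A z) (hx0 : x ≠ 0) : conj z = z := by
  obtain ⟨h, hx⟩ := mem_eigenspace_iff.mp hx
  have h1 := hA ⟨x, h⟩ ⟨x, h⟩
  rw [hx, inner_smul_left, inner_smul_right] at h1
  exact mul_right_cancel₀ (inner_self_ne_zero.mpr hx0) h1

theorem inner_eigenvector_eq_zero {A : E →ₗ.[ℂ] E} (hA : A.IsFormalAdjoint A) {z w : ℂ} {x y : E}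
    (hx : x ∈ eigenspace A z) (hy : y ∈ eigenspace A w) (hzw : z ≠ w) : inner ℂ x y = 0 := by
  rcases eq_or_ne x 0 with rfl | hx0
  · exact inner_zero_left _
  have hz := eigenvalue_conj_eq hA hx hx0
  obtain ⟨h, hx⟩ := mem_eigenspace_iff.mp hx
  obtain ⟨h', hy⟩ := mem_eigenspace_iff.mp hy
  have h1 := hA ⟨x, h⟩ ⟨y, h'⟩
  rw [hx, hy, inner_smul_left, inner_smul_right, hz] at h1
  by_contra h0
  exact hzw (mul_right_cancel₀ h0 h1)

open Filter Topology in
-- The integrands are bounded by `1` and converge pointwise to the indicator of `{a}`, which is zero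
-- almost everywhere; dominated convergence applies.
theorem tendsto_integral_poisson {μ : Measure ℝ} [IsFiniteMeasure μ] {a : ℝ} (ha : μ {a} = 0) :
    Tendsto (fun n : ℕ => ∫ l : ℝ, (1 / ((n : ℝ) + 1)) ^ 2 /
      ((l - a) ^ 2 + (1 / ((n : ℝ) + 1)) ^ 2) ∂μ) atTop (𝓝 0) := by
  have : (0 : ℝ) = ∫ _ : ℝ, 0 ∂μ := by simp
  rw [this]
  refine tendsto_integral_of_dominated_convergence (fun _ => 1) ?_ (integrable_const _) ?_ ?_
  · intro n
    exact Measurable.aestronglyMeasurable (by fun_prop)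
  · intro n
    refine Eventually.of_forall fun l => ?_
    rw [Real.norm_of_nonneg (by positivity)]
    exact div_le_one_of_le₀ (by nlinarith [sq_nonneg (l - a)]) (by positivity)
  · have : ∀ᵐ l ∂μ, l ≠ a := by
      rw [ae_iff]; simpa using ha
    filter_upwards [this] with l hl
    have h1 : Tendsto (fun n : ℕ => (1 / ((n : ℝ) + 1)) ^ 2) atTop (𝓝 0) := by
      simpa using (tendsto_one_div_add_atTop_nhds_zero_nat (𝕜 := ℝ)).pow 2
    have h2 : (l - a) ^ 2 + 0 ≠ 0 := by
      rw [add_zero]; exact pow_ne_zero _ (sub_ne_zero.mpr hl)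
    have h3 := h1.div (h1.const_add ((l - a) ^ 2)) h2
    rw [zero_div] at h3
    exact h3

open Filter Topology in
/-- A vector whose spectral measure has no atom at `a` is orthogonal to the eigenvectors for `a`. -/
theorem inner_eigenvector_eq_zero_of_isSpectralMeasure {A : E →ₗ.[ℂ] E} (hA : A.IsFormalAdjoint A)
    {a : ℝ} {x ψ : E} (hx : x ∈ eigenspace A a) {μ : Measure ℝ} (hμ : IsSpectralMeasure A ψ μ)
    (ha : μ {a} = 0) : inner ℂ x ψ = 0 := by
  obtain ⟨hfin, hμ⟩ := hμ
  obtain ⟨hxd, hx⟩ := mem_eigenspace_iff.mp hx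
  -- For `z = a + iε` and `φ = (A - z)⁻¹ψ`, the eigenvector equation gives `(x, ψ) = -iε(x, φ)`,
  -- while `ε²‖φ‖² = ε Im (ψ, φ)` is the Poisson integral of `μ`.
  have hbound : ∀ n : ℕ, ‖inner ℂ x ψ‖ ^ 2 ≤ ‖x‖ ^ 2 * ∫ l : ℝ, (1 / ((n : ℝ) + 1)) ^ 2 /
      ((l - a) ^ 2 + (1 / ((n : ℝ) + 1)) ^ 2) ∂μ := by
    intro n
    set ε : ℝ := 1 / ((n : ℝ) + 1) with hε
    have hε0 : 0 < ε := by positivity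
    have hzim : ((a : ℂ) + ε * Complex.I).im = ε := by simp
    obtain ⟨φ, h1, h2⟩ := hμ (a + ε * Complex.I) (by rw [hzim]; exact hε0.ne')
    have h3 : inner ℂ x ψ = -(ε * Complex.I) * inner ℂ x (φ : E) := by
      rw [← h1, inner_sub_right, ← hA ⟨x, hxd⟩ φ, hx, inner_smul_left, inner_smul_right]
      simp; ring
    have h4 : ‖inner ℂ x ψ‖ ^ 2 ≤ ε ^ 2 * (‖x‖ ^ 2 * ‖(φ : E)‖ ^ 2) := by
      have : ‖-((ε : ℂ) * Complex.I)‖ = ε := by simp [abs_of_pos hε0]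
      rw [h3, norm_mul, mul_pow, this, ← mul_pow ‖x‖]
      gcongr
      exact norm_inner_le_norm _ _
    have h5 : (inner ℂ ψ (φ : E)).im = ε * ‖(φ : E)‖ ^ 2 := by
      rw [← inner_conj_symm, Complex.conj_im, ← h1, im_inner_apply_sub_smul hA, hzim, neg_neg]
    have h6 : ε * (inner ℂ ψ (φ : E)).im = ∫ l : ℝ, ε ^ 2 / ((l - a) ^ 2 + ε ^ 2) ∂μ := by
      have hInt : Integrable (fun l : ℝ => ((l : ℂ) - (a + ε * Complex.I))⁻¹) μ := by
        refine Integrable.of_bound (C := ε⁻¹) (Measurable.aestronglyMeasurable (by fun_prop)) ?_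
        refine Eventually.of_forall fun l => ?_
        rw [norm_inv]
        refine inv_anti₀ hε0 ?_
        refine le_trans ?_ (Complex.abs_im_le_norm _)
        simp [abs_of_pos hε0]
      have h7 := integral_im (𝕜 := ℂ) hInt
      simp only [RCLike.im_eq_complex_im] at h7
      rw [h2, ← h7, ← integral_const_mul]
      refine integral_congr_ae (Eventually.of_forall fun l => ?_)
      simp only [Complex.inv_im, Complex.normSq_apply]
      simp
      ring
    calc ‖inner ℂ x ψ‖ ^ 2 ≤ ε ^ 2 * (‖x‖ ^ 2 * ‖(φ : E)‖ ^ 2) := h4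
      _ = ‖x‖ ^ 2 * (ε * (inner ℂ ψ (φ : E)).im) := by rw [h5]; ring
      _ = _ := by rw [h6]
  have hlim := (tendsto_integral_poisson ha).const_mul (‖x‖ ^ 2)
  rw [mul_zero] at hlim
  have := ge_of_tendsto' hlim hbound
  have h0 : ‖inner ℂ x ψ‖ = 0 := by
    have := le_antisymm this (sq_nonneg _)
    exact pow_eq_zero_iff two_ne_zero |>.mp this
  exact norm_eq_zero.mp h0

/-- Points are Lebesgue null, so an absolutely continuous spectral measure has no atoms. Only real
eigenvalues matter, and orthogonality survives spans and closures. -/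
theorem acSubspace_isOrtho_ppSubspace {A : E →ₗ.[ℂ] E} (hA : A.IsFormalAdjoint A) :
    acSubspace A ⟂ ppSubspace A := by
  have key : ∀ ψ ∈ {ψ | ∃ μ : Measure ℝ, IsSpectralMeasure A ψ μ ∧ μ ≪ volume}, ∀ z,
      ∀ x ∈ eigenspace A z, inner ℂ x ψ = 0 := by
    rintro ψ ⟨μ, hμ, hac⟩ z x hx
    rcases eq_or_ne x 0 with rfl | hx0
    · exact inner_zero_left _
    have hz : (z.re : ℂ) = z := Complex.conj_eq_iff_re.mp (eigenvalue_conj_eq hA hx hx0)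
    rw [← hz] at hx
    exact inner_eigenvector_eq_zero_of_isSpectralMeasure hA hx hμ (hac (by simp))
  have h1 : Submodule.span ℂ {ψ | ∃ μ : Measure ℝ, IsSpectralMeasure A ψ μ ∧ μ ≪ volume} ⟂
      (⨆ z : ℂ, eigenspace A z) := by
    rw [Submodule.isOrtho_iSup_right]
    intro z
    rw [Submodule.isOrtho_iff_le, Submodule.span_le]
    intro ψ hψ x hx
    exact key ψ hψ z x hx
  rw [Submodule.isOrtho_iff_le] at h1 ⊢
  have h2 := Submodule.topologicalClosure_minimal _ h1 (Submodule.isClosed_orthogonal _)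
  rw [ppSubspace, Submodule.orthogonal_closure]
  exact h2

end Subspaces

/-! ### Spectral measures and spectral projections for representations of `C(X, ℂ)`. -/

section FunctionalCalculus

variable {E : Type*} [NormedAddCommGroup E] [InnerProductSpace ℂ E] [CompleteSpace E]
variable {X : Type*} [TopologicalSpace X]

/-- A real continuous function, regarded as a complex one. -/
def ofRealMap (f : C(X, ℝ)) : C(X, ℂ) := ⟨fun x => (f x : ℂ), by fun_prop⟩

theorem inner_starAlgHom_left (Φ : C(X, ℂ) →⋆ₐ[ℂ] (E →L[ℂ] E)) (f : C(X, ℂ)) (x y : E) :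
    inner ℂ (Φ f x) y = inner ℂ x (Φ (star f) y) := by
  rw [map_star, ContinuousLinearMap.star_eq_adjoint, ContinuousLinearMap.adjoint_inner_right]

theorem im_inner_starAlgHom_ofRealMap (Φ : C(X, ℂ) →⋆ₐ[ℂ] (E →L[ℂ] E)) (ψ : E) (f : C(X, ℝ)) :
    (inner ℂ ψ (Φ (ofRealMap f) ψ)).im = 0 := by
  have hs : star (ofRealMap f) = ofRealMap f := by
    ext x; simp [ofRealMap]
  have h := inner_starAlgHom_left Φ (ofRealMap f) ψ ψ
  rw [hs, ← inner_conj_symm] at h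
  have := congrArg Complex.im h
  simp only [Complex.conj_im] at this
  linarith

theorem inner_starAlgHom_mul_self (Φ : C(X, ℂ) →⋆ₐ[ℂ] (E →L[ℂ] E)) (ψ : E) (f : C(X, ℂ)) :
    inner ℂ ψ (Φ (star f * f) ψ) = (‖Φ f ψ‖ : ℂ) ^ 2 := by
  rw [map_mul]
  change inner ℂ ψ (Φ (star f) (Φ f ψ)) = _
  rw [← inner_starAlgHom_left, inner_self_eq_norm_sq_to_K]
  rfl

variable [CompactSpace X] [T2Space X] [MeasurableSpace X] [BorelSpace X]

open CompactlySupported in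
-- The functional `f ↦ (ψ, Φ(f)ψ)` is positive on real functions, so the Riesz–Markov theorem
-- represents it; complex `f` are split into real and imaginary parts.
theorem exists_measure_inner_starAlgHom (Φ : C(X, ℂ) →⋆ₐ[ℂ] (E →L[ℂ] E)) (ψ : E) :
    ∃ ν : Measure X, IsFiniteMeasure ν ∧ ν.Regular ∧
      ∀ f : C(X, ℂ), ∫ x, f x ∂ν = inner ℂ ψ (Φ f ψ) := by
  let Λ₀ : C_c(X, ℝ) →ₗ[ℝ] ℝ :=
    { toFun := fun f => (inner ℂ ψ (Φ (ofRealMap f.toContinuousMap) ψ)).re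
      map_add' := by
        intro f g
        have : ofRealMap (f + g).toContinuousMap =
            ofRealMap f.toContinuousMap + ofRealMap g.toContinuousMap := by
          ext x; simp [ofRealMap]
        rw [this, map_add, _root_.add_apply, inner_add_right, Complex.add_re]
      map_smul' := by
        intro c f
        have : ofRealMap (c • f).toContinuousMap =
            (c : ℂ) • ofRealMap f.toContinuousMap := by
          ext x; simp [ofRealMap]
        rw [this, map_smul, _root_.smul_apply, inner_smul_right]
        simp }
  have hΛ₀ : ∀ f, 0 ≤ f → 0 ≤ Λ₀ f := by
    intro f hf
    -- Positivity: with `g = √f` one has `(ψ, Φ(f)ψ) = ‖Φ(g)ψ‖²`.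
    let g : C(X, ℂ) := ⟨fun x => (Real.sqrt (f x) : ℂ), by fun_prop⟩
    have hg : ofRealMap f.toContinuousMap = star g * g := by
      ext x
      simp only [ofRealMap, g, ContinuousMap.coe_mk, ContinuousMap.mul_apply,
        ContinuousMap.star_apply, RCLike.star_def, Complex.conj_ofReal]
      rw [← Complex.ofReal_mul, Real.mul_self_sqrt (hf x)]
      rfl
    change 0 ≤ (inner ℂ ψ (Φ (ofRealMap f.toContinuousMap) ψ)).re
    rw [hg, inner_starAlgHom_mul_self, ← Complex.ofReal_pow, Complex.ofReal_re]
    positivity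
  let Λ := PositiveLinearMap.mk₀ Λ₀ hΛ₀
  refine ⟨RealRMK.rieszMeasure Λ, inferInstance, inferInstance, fun f => ?_⟩
  have hreal : ∀ g : C(X, ℝ), ((∫ x, g x ∂(RealRMK.rieszMeasure Λ) : ℝ) : ℂ) =
      inner ℂ ψ (Φ (ofRealMap g) ψ) := by
    intro g
    have h1 := RealRMK.integral_rieszMeasure Λ ⟨g, HasCompactSupport.of_compactSpace g⟩
    have h2 : Λ ⟨g, HasCompactSupport.of_compactSpace g⟩ =
      (inner ℂ ψ (Φ (ofRealMap g) ψ)).re := rfl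
    refine Complex.ext ?_ ?_
    · rw [Complex.ofReal_re, ← h2, ← h1]; rfl
    · rw [Complex.ofReal_im, im_inner_starAlgHom_ofRealMap]
  let fr : C(X, ℝ) := ⟨fun x => (f x).re, by fun_prop⟩
  let fi : C(X, ℝ) := ⟨fun x => (f x).im, by fun_prop⟩
  have hf : f = ofRealMap fr + Complex.I • ofRealMap fi := by
    ext x
    simp [ofRealMap, fr, fi, mul_comm Complex.I]
  have hInt : Integrable (fun x => f x) (RealRMK.rieszMeasure Λ) :=
    f.continuous.integrable_of_hasCompactSupport (HasCompactSupport.of_compactSpace f)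
  have h1 := integral_re_add_im (𝕜 := ℂ) hInt
  rw [← h1]
  have h2 := hreal fr
  have h3 := hreal fi
  nth_rw 3 [hf]
  rw [map_add, map_smul, _root_.add_apply, _root_.smul_apply,
    inner_add_right, inner_smul_right, ← h2, ← h3, mul_comm Complex.I]
  rfl

open scoped ENNReal in
/-- The vectors `E(B)ψ`, where `E` is the projection-valued measure of a representation of
`C(X, ℂ)`. -/
theorem exists_spectral_projections [SecondCountableTopology X]
    (Φ : C(X, ℂ) →⋆ₐ[ℂ] (E →L[ℂ] E)) (ψ : E) :
    ∃ ν : Measure X, IsFiniteMeasure ν ∧ ∃ P : Set X → E, P Set.univ = ψ ∧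
      ∀ B B', MeasurableSet B → MeasurableSet B' → ∀ f : C(X, ℂ),
        inner ℂ (P B) (Φ f (P B')) = ∫ x in B ∩ B', f x ∂ν := by
  obtain ⟨ν, hfin, hreg, hν⟩ := exists_measure_inner_starAlgHom Φ ψ
  let e : C(X, ℂ) →L[ℂ] Lp ℂ 2 ν := ContinuousMap.toLp 2 ν ℂ
  have he : ∀ f, e f =ᵐ[ν] f := fun f => ContinuousMap.coeFn_toLp ν f
  have hdense : DenseRange e := ContinuousMap.toLp_denseRange ℂ ν ℂ (by simp)
  let W₀ : C(X, ℂ) →ₗ[ℂ] E :=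
    { toFun := fun f => Φ f ψ
      map_add' := fun f g => by rw [map_add]; rfl
      map_smul' := fun c f => by rw [map_smul]; rfl }
  have hnorm : ∀ f, ‖W₀ f‖ = ‖e f‖ := by
    intro f
    have h1 : inner ℂ (e f) (e f) = ∫ x, (star f * f) x ∂ν := by
      rw [L2.inner_def]
      refine integral_congr_ae ?_
      filter_upwards [he f] with x hx
      rw [hx]
      simp [mul_comm, Complex.mul_conj, Complex.normSq_eq_norm_sq]
    rw [hν, inner_starAlgHom_mul_self, inner_self_eq_norm_sq_to_K] at h1
    have h2 : ‖e f‖ ^ 2 = ‖Φ f ψ‖ ^ 2 := Complex.ofReal_injective (by push_cast; exact h1)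
    exact ((sq_eq_sq₀ (norm_nonneg _) (norm_nonneg _)).mp h2).symm
  -- `f ↦ Φ(f)ψ` is isometric for the norm of `L²(ν)`, so it extends from the dense continuous
  -- functions to an isometry `W`. It intertwines multiplication by `f` with `Φ(f)`, and `W` applied
  -- to the indicator of `B` serves as `P B`.
  let W : Lp ℂ 2 ν →L[ℂ] E := W₀.extendOfNorm (e : C(X, ℂ) →ₗ[ℂ] Lp ℂ 2 ν)
  have hW : ∀ f, W (e f) = Φ f ψ := fun f =>
    LinearMap.extendOfNorm_eq (f := W₀) (e := (e : C(X, ℂ) →ₗ[ℂ] Lp ℂ 2 ν)) hdense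
      ⟨1, fun x => by rw [one_mul]; exact (hnorm x).le⟩ f
  have hWnorm : ∀ u, ‖W u‖ = ‖u‖ := by
    refine congrFun (hdense.equalizer (g := fun u => ‖W u‖) (h := fun u => ‖u‖)
      (by fun_prop) (by fun_prop) (funext fun f => ?_))
    simp only [Function.comp_apply, hW]
    exact hnorm f
  let Wi : Lp ℂ 2 ν →ₗᵢ[ℂ] E := ⟨(W : Lp ℂ 2 ν →ₗ[ℂ] E), hWnorm⟩
  have hWinner : ∀ u v, inner ℂ (W u) (W v) = inner ℂ u v := Wi.inner_map_map
  let M : C(X, ℂ) → Lp ℂ 2 ν →L[ℂ] Lp ℂ 2 ν := fun f =>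
    (ContinuousLinearMap.mul ℂ ℂ).holderL ν ∞ 2 2 (ContinuousMap.toLp ∞ ν ℂ f)
  have hM : ∀ f u, M f u =ᵐ[ν] fun x => f x * u x := by
    intro f u
    have h1 : M f u =ᵐ[ν] _ := ContinuousLinearMap.coeFn_holder (ContinuousLinearMap.mul ℂ ℂ)
      (ContinuousMap.toLp ∞ ν ℂ f : Lp ℂ ∞ ν) u
    filter_upwards [h1, ContinuousMap.coeFn_toLp (p := ∞) (𝕜 := ℂ) ν f] with x h1 h2
    rw [h1, h2]; rfl
  have hMW : ∀ f u, Φ f (W u) = W (M f u) := by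
    intro f
    refine congrFun (hdense.equalizer (g := fun u => Φ f (W u)) (h := fun u => W (M f u))
      (by fun_prop) (by fun_prop) (funext fun g => ?_))
    have : M f (e g) = e (f * g) := by
      apply Lp.ext
      filter_upwards [hM f (e g), he g, he (f * g)] with x h1 h2 h3
      rw [h1, h2, h3]; rfl
    simp only [Function.comp_apply, this, hW, map_mul]
    rfl
  classical
  let χ : ∀ B, MeasurableSet B → Lp ℂ 2 ν := fun B hB =>
    indicatorConstLp 2 hB (measure_ne_top ν B) (1 : ℂ)
  refine ⟨ν, hfin, fun B => if h : MeasurableSet B then W (χ B h) else 0, ?_, ?_⟩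
  · have h1 : χ Set.univ MeasurableSet.univ = e 1 := by
      apply Lp.ext
      filter_upwards [indicatorConstLp_coeFn (p := 2) (hs := MeasurableSet.univ)
        (hμs := measure_ne_top ν Set.univ) (c := (1 : ℂ)), he 1] with x h1 h2
      rw [h2, h1]
      simp
    simp only
    rw [dif_pos MeasurableSet.univ, h1, hW, map_one]
    rfl
  · intro B B' hB hB' f
    simp only
    rw [dif_pos hB, dif_pos hB', hMW, hWinner, L2.inner_indicatorConstLp_one,
      ← setIntegral_indicator hB']
    refine integral_congr_ae (ae_restrict_of_ae ?_)
    filter_upwards [hM f (χ B' hB'), indicatorConstLp_coeFn (p := 2) (hs := hB')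
        (hμs := measure_ne_top ν B') (c := (1 : ℂ))] with x h1 h2
    rw [h1, h2]
    by_cases hx : x ∈ B' <;> simp [hx]

end FunctionalCalculus

/-! ### The spectral theorem for one vector and the decomposition of the Hilbert space. -/

section SpectralTheorem

variable {E : Type*} [NormedAddCommGroup E] [InnerProductSpace ℂ E]

/-- The inner products `(P B, P B')` alone decide the matter: the squared norm of the difference of
both sides expands into measures that cancel. -/
theorem spectral_projection_union {μ : Measure ℝ} [IsFiniteMeasure μ] {P : Set ℝ → E}
    (hP : ∀ B B', MeasurableSet B → MeasurableSet B' →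
      inner ℂ (P B) (P B') = (μ.real (B ∩ B') : ℂ))
    {B C : Set ℝ} (hB : MeasurableSet B) (hC : MeasurableSet C) (hd : Disjoint B C) :
    P (B ∪ C) = P B + P C := by
  have hBC : B ∩ C = ∅ := hd.inter_eq
  have hCB : C ∩ B = ∅ := hd.symm.inter_eq
  have h : inner ℂ (P (B ∪ C) - (P B + P C)) (P (B ∪ C) - (P B + P C)) = 0 := by
    simp only [inner_sub_left, inner_sub_right, inner_add_left, inner_add_right,
      hP _ _ (hB.union hC) (hB.union hC), hP _ _ (hB.union hC) hB, hP _ _ (hB.union hC) hC,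
      hP _ _ hB (hB.union hC), hP _ _ hC (hB.union hC), hP _ _ hB hB, hP _ _ hC hC,
      hP _ _ hB hC, hP _ _ hC hB, Set.inter_self, Set.union_inter_cancel_left,
      Set.union_inter_cancel_right,
      Set.inter_eq_self_of_subset_left Set.subset_union_left,
      Set.inter_eq_self_of_subset_left Set.subset_union_right, hBC, hCB,
      measureReal_union (μ := μ) hd hC, measureReal_empty]
    push_cast
    ring
  exact sub_eq_zero.mp (inner_self_eq_zero.mp h)

open Filter Topology in
-- Exhaust `S` by finite sets `F n`: the identity `‖P (F n) - P S‖² = μ(S) - μ(F n)` turns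
-- continuity of the measure into norm convergence. This will place the atomic part of a vector in
-- the closed span of eigenvectors.
theorem spectral_projection_countable_mem {μ : Measure ℝ} [IsFiniteMeasure μ] {P : Set ℝ → E}
    (hP : ∀ B B', MeasurableSet B → MeasurableSet B' →
      inner ℂ (P B) (P B') = (μ.real (B ∩ B') : ℂ))
    {K : Submodule ℂ E} (hK : IsClosed (K : Set E)) (hPK : ∀ a, P {a} ∈ K) {S : Set ℝ}
    (hS : S.Countable) : P S ∈ K := by
  have hempty : P ∅ = 0 := by
    have := hP ∅ ∅ .empty .empty
    simpa using this
  have hfinite : ∀ F : Finset ℝ, P F ∈ K := by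
    intro F
    induction F using Finset.induction_on with
    | empty => simp [hempty]
    | insert a F ha ih =>
      rw [Finset.coe_insert, Set.insert_eq,
        spectral_projection_union hP (measurableSet_singleton a) F.measurableSet
          (by simpa using ha)]
      exact K.add_mem (hPK a) ih
  rcases S.eq_empty_or_nonempty with rfl | hne
  · rw [hempty]; exact K.zero_mem
  obtain ⟨f, rfl⟩ := hS.exists_eq_range hne
  let F : ℕ → Finset ℝ := fun n => (Finset.range n).image f
  have hmono : Monotone fun n => (F n : Set ℝ) := by
    intro m n hmn
    simp only [F, Finset.coe_image]
    exact Set.image_mono (by simpa using hmn)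
  have hunion : ⋃ n, (F n : Set ℝ) = Set.range f := by
    ext x
    simp only [F, Set.mem_iUnion, Finset.coe_image, Set.mem_image, Finset.coe_range, Set.mem_Iio,
      Set.mem_range]
    exact ⟨fun ⟨_, k, _, h⟩ => ⟨k, h⟩, fun ⟨k, h⟩ => ⟨k + 1, k, k.lt_succ_self, h⟩⟩
  have hlim := (ENNReal.tendsto_toReal (measure_ne_top μ (⋃ n, (F n : Set ℝ)))).comp
    (tendsto_measure_iUnion_atTop (μ := μ) hmono)
  rw [hunion] at hlim
  have hSm : MeasurableSet (Set.range f) := (Set.countable_range f).measurableSet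
  have hsub : ∀ n, (F n : Set ℝ) ⊆ Set.range f := fun n =>
    hunion ▸ Set.subset_iUnion (fun n => (F n : Set ℝ)) n
  have hdist : ∀ n, ‖P (F n) - P (Set.range f)‖ ^ 2 = μ.real (Set.range f) - μ.real (F n) := by
    intro n
    apply Complex.ofReal_injective
    have hF := (F n).measurableSet
    have : ((‖P (F n) - P (Set.range f)‖ ^ 2 : ℝ) : ℂ) =
        inner ℂ (P (F n) - P (Set.range f)) (P (F n) - P (Set.range f)) := by
      rw [inner_self_eq_norm_sq_to_K]; simp
    rw [this]
    simp only [inner_sub_left, inner_sub_right, hP _ _ hF hF, hP _ _ hF hSm, hP _ _ hSm hF,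
      hP _ _ hSm hSm, Set.inter_self, Set.inter_eq_self_of_subset_left (hsub n),
      Set.inter_eq_self_of_subset_right (hsub n)]
    push_cast
    ring
  have hconv : Tendsto (fun n => P (F n)) atTop (𝓝 (P (Set.range f))) := by
    rw [tendsto_iff_norm_sub_tendsto_zero]
    have h1 : Tendsto (fun n => ‖P (F n) - P (Set.range f)‖ ^ 2) atTop (𝓝 0) := by
      simp only [hdist]
      have := hlim.const_sub (μ.real (Set.range f))
      rw [show μ.real (Set.range f) - (μ (Set.range f)).toReal = 0 from sub_self _] at this
      exact this
    have h2 := h1.sqrt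
    simpa [Real.sqrt_sq (norm_nonneg _)] using h2
  exact hK.mem_of_tendsto hconv (Eventually.of_forall fun n => hfinite _)

variable [CompleteSpace E]

/-- The resolvent of a self-adjoint operator at `i`, a normal operator. -/
theorem exists_resolvent_I {A : E →ₗ.[ℂ] E} (hA : IsSelfAdjoint A) :
    ∃ R : E →L[ℂ] E,
      (∀ x : E, ∃ h : R x ∈ A.domain, A ⟨R x, h⟩ - Complex.I • R x = x) ∧
      IsStarNormal R ∧ R - star R = (2 * Complex.I) • (R * star R) := by
  have hs := isFormalAdjoint_of_isSelfAdjoint hA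
  obtain ⟨R, hR1, hR2⟩ := mem_resolventSet_of_im_ne_zero hA (z := Complex.I) (by simp)
  obtain ⟨S, hS1, hS2⟩ := mem_resolventSet_of_im_ne_zero hA (z := -Complex.I) (by simp)
  have hstar : star R = S := by
    rw [ContinuousLinearMap.star_eq_adjoint, eq_comm, ContinuousLinearMap.eq_adjoint_iff]
    intro x y
    obtain ⟨hx, hx'⟩ := hS1 x
    obtain ⟨hy, hy'⟩ := hR1 y
    have := hs ⟨S x, hx⟩ ⟨R y, hy⟩
    nth_rw 2 [← hx']
    nth_rw 1 [← hy']
    rw [inner_sub_left, inner_sub_right, this, inner_smul_left, inner_smul_right]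
    simp
  -- The resolvent identity between `i` and `-i`, in both orders; comparing the two shows that `R`
  -- commutes with its adjoint `S`.
  have h1 : R - S = (2 * Complex.I) • (R * S) := by
    ext x
    obtain ⟨hx, hx'⟩ := hS1 x
    have h := hR2 ⟨S x, hx⟩
    have h' : A ⟨S x, hx⟩ = x - Complex.I • S x := by
      rw [neg_smul, sub_neg_eq_add] at hx'
      exact eq_sub_of_add_eq hx'
    rw [h', sub_sub, ← two_smul ℂ, smul_smul, map_sub, map_smul] at h
    change R x - S x = (2 * Complex.I) • R (S x)
    simp only at h
    nth_rw 1 [← h]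
    rw [sub_sub_cancel]
  have h2 : R - S = (2 * Complex.I) • (S * R) := by
    ext x
    obtain ⟨hx, hx'⟩ := hR1 x
    have h := hS2 ⟨R x, hx⟩
    have h' : A ⟨R x, hx⟩ = x + Complex.I • R x := by
      rw [sub_eq_iff_eq_add] at hx'
      exact hx'
    rw [h', neg_smul, sub_neg_eq_add, add_assoc, ← two_smul ℂ, smul_smul, map_add, map_smul] at h
    change R x - S x = (2 * Complex.I) • S (R x)
    simp only at h
    nth_rw 1 [← h]
    rw [add_sub_cancel_left]
  refine ⟨R, hR1, ⟨?_⟩, by rw [hstar, h1]⟩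
  rw [hstar]
  have h3 : (2 * Complex.I) • (S * R) = (2 * Complex.I) • (R * S) := by rw [← h1, h2]
  exact smul_right_injective _ (by simp : (2 * Complex.I) ≠ 0) h3

/-- The spectral theorem for a single vector: `P B = E_A(B)ψ`, with `E_A` the projection-valued
measure of `A` and `μ` the spectral measure of `ψ`. -/
theorem exists_spectral_projections_of_isSelfAdjoint {A : E →ₗ.[ℂ] E} (hA : IsSelfAdjoint A)
    (ψ : E) :
    ∃ μ : Measure ℝ, IsFiniteMeasure μ ∧ ∃ P : Set ℝ → E, P Set.univ = ψ ∧
      (∀ B B', MeasurableSet B → MeasurableSet B' →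
        inner ℂ (P B) (P B') = (μ.real (B ∩ B') : ℂ)) ∧
      (∀ B, MeasurableSet B → IsSpectralMeasure A (P B) (μ.restrict B)) ∧
      ∀ a : ℝ, P {a} ∈ eigenspace A a := by
  obtain ⟨R, hR, hnormal, hres⟩ := exists_resolvent_I hA
  have hinj : ∀ x, R x = 0 → x = 0 := by
    intro x hx
    obtain ⟨h1, h2⟩ := hR x
    have : (⟨R x, h1⟩ : A.domain) = 0 := Subtype.ext hx
    rw [← h2, this, LinearPMap.map_zero, hx, smul_zero, sub_zero]
  let X := _root_.spectrum ℂ R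
  let Φ : C(X, ℂ) →⋆ₐ[ℂ] (E →L[ℂ] E) := cfcHom hnormal
  let w : C(X, ℂ) := ⟨fun x => (x : ℂ), by fun_prop⟩
  have hw : Φ w = R := cfcHom_id hnormal
  have hΦ : Function.Injective Φ := cfcHom_injective hnormal
  -- The spectrum of `R` lies on the circle that is the image of the real line and `∞` under `λ ↦
  -- 1/(λ - i)`.
  have hcirc : ∀ x : X, (x : ℂ) - conj (x : ℂ) = 2 * Complex.I * (x * conj (x : ℂ)) := by
    have h1 : w - star w = (2 * Complex.I) • (w * star w) := by
      apply hΦ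
      rw [map_sub, map_smul, map_mul, map_star, hw, hres]
    intro x
    have := congrArg (fun f : C(X, ℂ) => f x) h1
    simpa [w] using this
  -- The inverse map `λ = 1/x + i`, taken as a real part. Its value `0` at `x = 0`, the image of
  -- `∞`, is harmless because that point will be `ν`-null.
  let l : X → ℝ := fun x => ((x : ℂ)⁻¹).re
  have hlm : Measurable l := by
    have : Measurable fun x : X => (x : ℂ) := measurable_subtype_coe
    fun_prop
  have hl : ∀ x : X, (x : ℂ) ≠ 0 → ((l x : ℝ) : ℂ) = (x : ℂ)⁻¹ + Complex.I := by
    intro x hx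
    have hx' : conj (x : ℂ) ≠ 0 := by simpa using hx
    have h1 : (x : ℂ)⁻¹ - conj (x : ℂ)⁻¹ = -(2 * Complex.I) := by
      rw [map_inv₀]
      field_simp
      linear_combination -(hcirc x)
    have h2 : ((x : ℂ)⁻¹).im = -1 := by
      have := congrArg Complex.im h1
      simp only [Complex.sub_im, Complex.conj_im, Complex.neg_im, Complex.mul_im, Complex.re_ofNat,
        Complex.I_im, Complex.im_ofNat, Complex.I_re] at this
      linarith
    apply Complex.ext
    · simp [l]
    · simp only [Complex.ofReal_im, Complex.add_im, h2, Complex.I_im]; norm_num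
  obtain ⟨ν, hfin, P, hP1, hP2⟩ := exists_spectral_projections Φ ψ
  have hPsq : ∀ B, MeasurableSet B → ∀ f : C(X, ℂ), (∀ᵐ x ∂ν, x ∈ B → f x = 0) →
      Φ f (P B) = 0 := by
    intro B hB f hf
    have h1 := inner_starAlgHom_mul_self Φ (P B) f
    rw [hP2 B B hB hB, Set.inter_self, setIntegral_eq_zero_of_ae_eq_zero] at h1
    · have h2 : (‖Φ f (P B)‖ : ℂ) = 0 := pow_eq_zero_iff two_ne_zero |>.mp h1.symm
      exact norm_eq_zero.mp (Complex.ofReal_eq_zero.mp h2)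
    · filter_upwards [hf] with x hx hxB
      simp [hx hxB]
  have hPin : ∀ B B', MeasurableSet B → MeasurableSet B' →
      inner ℂ (P B) (P B') = (ν.real (B ∩ B') : ℂ) := by
    intro B B' hB hB'
    have := hP2 B B' hB hB' 1
    rw [map_one] at this
    simpa using this
  -- Mass at `0` would produce a non-zero vector in the kernel of `R`, but `R` is injective.
  have hzero : ∀ᵐ x : X ∂ν, (x : ℂ) ≠ 0 := by
    have hm : MeasurableSet {x : X | (x : ℂ) = 0} :=
      measurable_subtype_coe (measurableSet_singleton 0)
    have h1 : Φ w (P {x : X | (x : ℂ) = 0}) = 0 :=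
      hPsq _ hm _ (Filter.Eventually.of_forall fun x hx => hx)
    rw [hw] at h1
    have h2 := hPin _ _ hm hm
    rw [hinj _ h1, inner_zero_left, Set.inter_self, eq_comm, Complex.ofReal_eq_zero,
      measureReal_eq_zero_iff] at h2
    rw [ae_iff]
    simpa using h2
  refine ⟨ν.map l, inferInstance, fun B => P (l ⁻¹' B), by simpa using hP1, ?_, ?_, ?_⟩
  · intro B B' hB hB'
    rw [hPin _ _ (hlm hB) (hlm hB'), map_measureReal_apply hlm (hB.inter hB'), Set.preimage_inter]
  · intro B hB
    refine ⟨inferInstance, fun z hz => ?_⟩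
    have hden : ∀ x : X, 1 + (Complex.I - z) * (x : ℂ) ≠ 0 := by
      intro x h
      rcases eq_or_ne (x : ℂ) 0 with h0 | h0
      · rw [h0] at h; simp at h
      have h1 : ((l x : ℝ) : ℂ) = z := by
        rw [hl x h0]
        field_simp
        linear_combination h
      rw [← h1] at hz
      simp at hz
    -- This is `1/(λ - z)` in the coordinate `x`, in a form that stays continuous at `x = 0`; so `Φ
    -- g` is the resolvent at `z`.
    let g : C(X, ℂ) := ⟨fun x => (x : ℂ) / (1 + (Complex.I - z) * (x : ℂ)),
      Continuous.div (by fun_prop) (by fun_prop) hden⟩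
    have hg : g + (Complex.I - z) • (w * g) = w := by
      ext x
      have := hden x
      simp only [g, w, ContinuousMap.add_apply, ContinuousMap.smul_apply, ContinuousMap.mul_apply,
        ContinuousMap.coe_mk, smul_eq_mul]
      rw [mul_div_assoc', mul_div_assoc', ← add_div, div_eq_iff this]
      ring
    set u := P (l ⁻¹' B) with hu
    have h1 : Φ g u = R (u - (Complex.I - z) • Φ g u) := by
      have h2 := congrArg (fun f => Φ f u) hg
      simp only [map_add, map_smul, map_mul, hw] at h2
      change Φ g u + (Complex.I - z) • R (Φ g u) = R u at h2
      rw [map_sub, map_smul, ← h2, add_sub_cancel_right]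
    obtain ⟨h2, h3⟩ := hR (u - (Complex.I - z) • Φ g u)
    refine ⟨⟨_, h2⟩, ?_, ?_⟩
    · rw [sub_eq_iff_eq_add] at h3
      rw [h3]
      simp only [← h1]
      module
    · simp only [← h1]
      rw [hu, hP2 _ _ (hlm hB) (hlm hB), Set.inter_self, Measure.restrict_map hlm hB,
        integral_map hlm.aemeasurable]
      · refine integral_congr_ae (ae_restrict_of_ae ?_)
        filter_upwards [hzero] with x hx
        have := hden x
        have h4 : (x : ℂ)⁻¹ + Complex.I - z = (1 + (Complex.I - z) * x) / x := by
          field_simp; ring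
        rw [hl x hx, h4, inv_div]
        rfl
      · exact Measurable.aestronglyMeasurable (by fun_prop)
  · intro a
    have ha : (a : ℂ) - Complex.I ≠ 0 := by
      intro h
      have := congrArg Complex.im h
      simp at this
    set u := P (l ⁻¹' {a}) with hu
    -- On `{l = a}` the coordinate is the constant `1/(a - i)`, so `R u = (a - i)⁻¹ u`, which makes
    -- `u` a vector of the eigenspace of `A` for `a`.
    have h1 : Φ (w - algebraMap ℂ _ ((a : ℂ) - Complex.I)⁻¹) u = 0 := by
      refine hPsq _ (hlm (measurableSet_singleton a)) _ ?_
      filter_upwards [hzero] with x hx hxa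
      have h2 : l x = a := hxa
      have h3 := hl x hx
      rw [h2] at h3
      have h4 : (x : ℂ) = ((a : ℂ) - Complex.I)⁻¹ := by
        rw [h3, add_sub_cancel_right, inv_inv]
      simp [w, h4]
    rw [map_sub, hw, AlgHomClass.commutes, Algebra.algebraMap_eq_smul_one] at h1
    change R u - ((a : ℂ) - Complex.I)⁻¹ • u = 0 at h1
    have h2 : ((a : ℂ) - Complex.I) • R u = u := by
      rw [sub_eq_zero.mp h1, smul_smul, mul_inv_cancel₀ ha, one_smul]
    obtain ⟨h3, h4⟩ := hR u
    rw [sub_eq_iff_eq_add] at h4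
    rw [mem_eigenspace_iff]
    have h5 : u ∈ A.domain := by
      rw [← h2]; exact A.domain.smul_mem _ h3
    refine ⟨h5, ?_⟩
    have h6 : (⟨u, h5⟩ : A.domain) = ((a : ℂ) - Complex.I) • ⟨R u, h3⟩ := Subtype.ext h2.symm
    rw [h6, LinearPMap.map_smul, h4, smul_add, smul_comm, h2]
    module

/-- The decomposition of the Hilbert space with respect to a self-adjoint operator. -/
theorem acSubspace_sup_scSubspace_sup_ppSubspace {A : E →ₗ.[ℂ] E} (hA : IsSelfAdjoint A) :
    acSubspace A ⊔ scSubspace A ⊔ ppSubspace A = ⊤ := by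
  rw [Submodule.eq_top_iff']
  intro ψ
  obtain ⟨μ, hfin, P, hψ, hP, hsp, heig⟩ := exists_spectral_projections_of_isSelfAdjoint hA ψ
  let S : Set ℝ := {x | 0 < μ {x}}
  have hS : S.Countable := by
    have := Measure.countable_meas_level_set_pos (μ := μ) (g := id) measurable_id
    exact this
  have hSm : MeasurableSet S := hS.measurableSet
  -- With `S` the countable set of atoms, the line splits into `n \ S`, where `μ` is absolutely
  -- continuous, `nᶜ \ S`, which is Lebesgue null and free of atoms, and `S` itself.
  have hsing := Measure.mutuallySingular_singularPart μ volume
  set n := hsing.nullSet with hn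
  have hnm : MeasurableSet n := hsing.measurableSet_nullSet
  have hn1 : μ.singularPart volume n = 0 := hsing.measure_nullSet
  have hn2 : volume nᶜ = 0 := hsing.measure_compl_nullSet
  have hac : P (n \ S) ∈ acSubspace A := by
    refine Submodule.le_topologicalClosure _ (Submodule.subset_span
      ⟨_, hsp _ (hnm.diff hSm), ?_⟩)
    refine Measure.AbsolutelyContinuous.mk fun s hs h0 => ?_
    rw [Measure.restrict_apply hs, ← nonpos_iff_eq_zero, ← Measure.singularPart_add_rnDeriv μ volume,
      Measure.add_apply]
    have h1 : μ.singularPart volume (s ∩ (n \ S)) = 0 :=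
      measure_mono_null (Set.inter_subset_right.trans Set.sdiff_subset) hn1
    have h2 : (volume.withDensity (μ.rnDeriv volume)) (s ∩ (n \ S)) = 0 :=
      measure_mono_null Set.inter_subset_left (withDensity_absolutelyContinuous _ _ h0)
    rw [h1, h2, add_zero]
  have hsc : P (nᶜ \ S) ∈ scSubspace A := by
    refine Submodule.le_topologicalClosure _ (Submodule.subset_span
      ⟨_, hsp _ (hnm.compl.diff hSm), ?_, ?_⟩)
    · intro x
      rw [Measure.restrict_apply (measurableSet_singleton x)]
      by_cases hx : x ∈ S
      · have : {x} ∩ (nᶜ \ S) = ∅ := by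
          ext y; simp only [Set.mem_inter_iff, Set.mem_singleton_iff, Set.mem_sdiff,
            Set.mem_empty_iff_false, iff_false]
          rintro ⟨rfl, _, h⟩
          exact h hx
        rw [this, measure_empty]
      · have : μ {x} = 0 := by simpa [S] using hx
        exact measure_mono_null Set.inter_subset_left this
    · refine ⟨n, hnm, ?_, hn2⟩
      rw [Measure.restrict_apply hnm]
      have : n ∩ (nᶜ \ S) = ∅ := by
        ext y; simp only [Set.mem_inter_iff, Set.mem_sdiff, Set.mem_compl_iff,
            Set.mem_empty_iff_false, iff_false]
        rintro ⟨h, h', _⟩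
        exact h' h
      rw [this, measure_empty]
  have hpp : P S ∈ ppSubspace A :=
    spectral_projection_countable_mem hP (Submodule.isClosed_topologicalClosure _)
      (fun a => Submodule.le_topologicalClosure _ (Submodule.mem_iSup_of_mem _ (heig a))) hS
  have hsum : ψ = P (n \ S) + P (nᶜ \ S) + P S := by
    have h1 : P ((n \ S) ∪ (nᶜ \ S)) = P (n \ S) + P (nᶜ \ S) :=
      spectral_projection_union hP (hnm.diff hSm) (hnm.compl.diff hSm)
        (disjoint_compl_right.mono Set.sdiff_subset Set.sdiff_subset)
    have h2 : (n \ S) ∪ (nᶜ \ S) = Sᶜ := by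
      rw [← Set.union_sdiff_distrib, Set.union_compl_self, Set.compl_eq_univ_sdiff]
    have h3 : P (Sᶜ ∪ S) = P Sᶜ + P S :=
      spectral_projection_union hP hSm.compl hSm disjoint_compl_left
    rw [← h1, h2, ← h3, Set.compl_union_self, hψ]
  rw [hsum]
  exact Submodule.add_mem_sup (Submodule.add_mem_sup hac hsc) hpp

end SpectralTheorem

/-! ### Strong time operators: closures and dense CCR-domains. -/

section StrongTimeOperators

variable {E : Type*} [NormedAddCommGroup E] [InnerProductSpace ℂ E]

theorem mem_graph_iff_exists {A : E →ₗ.[ℂ] E} {x y : E} :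
    (x, y) ∈ A.graph ↔ ∃ h : x ∈ A.domain, A ⟨x, h⟩ = y := by
  rw [LinearPMap.mem_graph_iff]
  constructor
  · rintro ⟨⟨x', hx'⟩, rfl, h⟩
    exact ⟨hx', h⟩
  · rintro ⟨h, h'⟩
    exact ⟨⟨x, h⟩, rfl, h'⟩

theorem IsSymmetricOp.isClosable [CompleteSpace E] {T : E →ₗ.[ℂ] E} (hT : IsSymmetricOp T) :
    T.IsClosable :=
  LinearPMap.isClosable_iff_exists_closed_extension.mpr
    ⟨T.adjoint, LinearPMap.adjoint_isClosed hT.1, LinearPMap.IsFormalAdjoint.le_adjoint hT.1 hT.2⟩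

/-- Symmetry is a closed condition on pairs of points of the graph, so it extends to the closure in
one variable after the other. -/
theorem IsSymmetricOp.closure [CompleteSpace E] {T : E →ₗ.[ℂ] E} (hT : IsSymmetricOp T) :
    IsSymmetricOp T.closure := by
  refine ⟨hT.1.mono T.le_closure.1, ?_⟩
  have h0 : ∀ p ∈ T.graph, ∀ q ∈ T.graph, inner ℂ p.2 q.1 = inner ℂ p.1 q.2 := by
    rintro ⟨p1, p2⟩ hp ⟨q1, q2⟩ hq
    obtain ⟨hp', rfl⟩ := mem_graph_iff_exists.mp hp
    obtain ⟨hq', rfl⟩ := mem_graph_iff_exists.mp hq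
    exact hT.2 ⟨p1, hp'⟩ ⟨q1, hq'⟩
  have h1 : ∀ p ∈ _root_.closure (T.graph : Set (E × E)), ∀ q ∈ T.graph,
      inner ℂ p.2 q.1 = inner ℂ p.1 q.2 := by
    intro p hp q hq
    exact closure_minimal (s := (T.graph : Set (E × E)))
      (t := {p | inner ℂ p.2 q.1 = inner ℂ p.1 q.2}) (fun p hp => h0 p hp q hq)
      (isClosed_eq (by fun_prop) (by fun_prop)) hp
  have h2 : ∀ p ∈ _root_.closure (T.graph : Set (E × E)),
      ∀ q ∈ _root_.closure (T.graph : Set (E × E)), inner ℂ p.2 q.1 = inner ℂ p.1 q.2 := by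
    intro p hp q hq
    exact closure_minimal (s := (T.graph : Set (E × E)))
      (t := {q | inner ℂ p.2 q.1 = inner ℂ p.1 q.2}) (fun q hq => h1 p hp q hq)
      (isClosed_eq (by fun_prop) (by fun_prop)) hq
  have h3 : ∀ x : T.closure.domain, ((x : E), T.closure x) ∈
      _root_.closure (T.graph : Set (E × E)) := by
    intro x
    have := LinearPMap.mem_graph T.closure x
    rw [← hT.isClosable.graph_closure_eq_closure_graph] at this
    exact this
  exact fun x y => h2 _ (h3 x) _ (h3 y)

/-- The closure of a strong time operator is a strong time operator. -/
theorem IsStrongTimeOperator.closure [CompleteSpace E] {A T : E →ₗ.[ℂ] E}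
    (hT : IsStrongTimeOperator A T) : IsStrongTimeOperator A T.closure := by
  obtain ⟨hA, hs, U, hU, h⟩ := hT
  refine ⟨hA, hs.closure, U, hU, fun t ψ => ?_⟩
  rw [← mem_graph_iff_exists, ← hs.isClosable.graph_closure_eq_closure_graph]
  have h1 : ((ψ : E), T.closure ψ) ∈ _root_.closure (T.graph : Set (E × E)) := by
    have := LinearPMap.mem_graph T.closure ψ
    rw [← hs.isClosable.graph_closure_eq_closure_graph] at this
    exact this
  -- The time relation says that the continuous map `(x, y) ↦ (U_t x, U_t(y + t x))` sends the graph
  -- of `T` into itself; hence it does the same with the closure.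
  refine map_mem_closure (f := fun p : E × E => (U t p.1, U t (p.2 + (t : ℂ) • p.1)))
    (by fun_prop) h1 ?_
  rintro ⟨x, y⟩ hp
  obtain ⟨hx, rfl⟩ := mem_graph_iff_exists.mp hp
  exact mem_graph_iff_exists.mpr (h t ⟨x, hx⟩)

/-- The integral may be formed inside the complete subspace `K`. Applied to the graph of a closed
operator, it moves the operator under the integral sign. -/
theorem integral_mem_of_isClosed {F : Type*} [NormedAddCommGroup F] [NormedSpace ℂ F]
    [CompleteSpace F] {K : Submodule ℂ F} (hK : IsClosed (K : Set F)) {g : ℝ → F}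
    (hg : Continuous g) (hgs : HasCompactSupport g) (hgK : ∀ t, g t ∈ K) :
    ∫ t, g t ∈ K := by
  have : CompleteSpace K := hK.completeSpace_coe
  let g' : ℝ → K := fun t => ⟨g t, hgK t⟩
  have hg' : Continuous g' := hg.subtype_mk _
  have hgs' : HasCompactSupport g' := by
    refine hgs.mono' (fun t ht => subset_tsupport _ ?_)
    simp only [Function.mem_support] at ht ⊢
    exact fun h => ht (Subtype.ext h)
  have := K.subtypeL.integral_comp_comm (hg'.integrable_of_hasCompactSupport hgs' (μ := volume))
  have h2 : ∫ t, g t = K.subtypeL (∫ t, g' t) := this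
  rw [h2]
  exact (∫ t, g' t).2

/-- `∫ f(t) e^{itA} ψ dt`, where `U t = e^{-itA}`. -/
def smear (U : ℝ → E →L[ℂ] E) (f : ℝ → ℝ) (ψ : E) : E := ∫ t, f t • U (-t) ψ

variable {A : E →ₗ.[ℂ] E} {U : ℝ → E →L[ℂ] E}

theorem IsUnitaryGroup.integrable_smear (hU : IsUnitaryGroup A U) {f : ℝ → ℝ} (hf : Continuous f)
    (hfs : HasCompactSupport f) (ψ : E) : Integrable fun t => f t • U (-t) ψ := by
  have := (hU.continuous ψ).comp continuous_neg
  exact (hf.smul this).integrable_of_hasCompactSupport hfs.smul_right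

theorem smear_eq_convolution (U : ℝ → E →L[ℂ] E) (f : ℝ → ℝ) (ψ : E) :
    smear U f ψ = convolution f (fun t => U t ψ) (ContinuousLinearMap.lsmul ℝ ℝ) volume 0 := by
  simp [smear, convolution]

theorem IsUnitaryGroup.smear_eq_convolution [CompleteSpace E] (hU : IsUnitaryGroup A U)
    {f : ℝ → ℝ} (hf : Continuous f) (hfs : HasCompactSupport f) (ψ : E) (s : ℝ) :
    U s (smear U f ψ) =
      convolution f (fun t => U t ψ) (ContinuousLinearMap.lsmul ℝ ℝ) volume s := by
  rw [smear, ← (U s).integral_comp_comm (hU.integrable_smear hf hfs ψ), convolution]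
  refine integral_congr_ae (Filter.Eventually.of_forall fun t => ?_)
  simp only [ContinuousLinearMap.lsmul_apply]
  rw [sub_eq_add_neg, hU.map_add]
  change U s (f t • U (-t) ψ) = f t • U s (U (-t) ψ)
  rw [(U s).map_smul_of_tower]

/-- The orbit of a smeared vector is a convolution with `f`, so differentiating it at `0` puts the
derivative on `f`; the generator property then reads off `A`. -/
theorem IsUnitaryGroup.smear_mem_graph [CompleteSpace E] (hU : IsUnitaryGroup A U) {f : ℝ → ℝ}
    (hf : ContDiff ℝ 1 f) (hfs : HasCompactSupport f) (ψ : E) :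
    (smear U f ψ, Complex.I • smear U (deriv f) ψ) ∈ A.graph := by
  rw [mem_graph_iff_exists, hU.generator]
  have h1 := hfs.hasDerivAt_convolution_left (ContinuousLinearMap.lsmul ℝ ℝ) hf
    ((hU.continuous ψ).locallyIntegrable (μ := volume)) 0
  have h2 : -(Complex.I • Complex.I • smear U (deriv f) ψ) = smear U (deriv f) ψ := by
    rw [smul_smul, Complex.I_mul_I]; simp
  rw [h2, TimeOperator.smear_eq_convolution U (deriv f)]
  convert h1 using 1
  exact funext fun s => hU.smear_eq_convolution hf.continuous hfs ψ s

theorem IsUnitaryGroup.smear_add_fun (hU : IsUnitaryGroup A U) {f g : ℝ → ℝ} (hf : Continuous f)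
    (hfs : HasCompactSupport f) (hg : Continuous g) (hgs : HasCompactSupport g) (ψ : E) :
    smear U (fun t => f t + g t) ψ = smear U f ψ + smear U g ψ := by
  simp only [smear, add_smul]
  exact integral_add (hU.integrable_smear hf hfs ψ) (hU.integrable_smear hg hgs ψ)

variable {T : E →ₗ.[ℂ] E}

/-- Integrate `T e^{itA}ψ = e^{itA}(T - t)ψ` against `f`. Closedness of `T` is what permits this. -/
theorem IsUnitaryGroup.smear_mem_graph_time [CompleteSpace E] (hU : IsUnitaryGroup A U)
    (hT : T.IsClosed)
    (h : ∀ (t : ℝ) (ψ : T.domain), ∃ h : U t ψ ∈ T.domain,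
      T ⟨U t ψ, h⟩ = U t (T ψ + (t : ℂ) • (ψ : E)))
    {f : ℝ → ℝ} (hf : Continuous f) (hfs : HasCompactSupport f) (ψ : T.domain) :
    (smear U f ψ, smear U f (T ψ) - smear U (fun t => t * f t) ψ) ∈ T.graph := by
  have hc : ∀ x : E, Continuous fun t => U (-t) x := fun x => (hU.continuous x).comp continuous_neg
  have hfs' : HasCompactSupport fun t => t * f t := hfs.mul_left
  have hf' : Continuous fun t => t * f t := by fun_prop
  have hcψ := hc ψ
  have hcT := hc (T ψ)
  have hmem : ∀ t, (f t • U (-t) (ψ : E),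
      f t • U (-t) (T ψ) - (t * f t) • U (-t) (ψ : E)) ∈ T.graph := by
    intro t
    have h1 := mem_graph_iff_exists.mpr (h (-t) ψ)
    have h2 := T.graph.smul_mem (f t : ℂ) h1
    have h3 : (f t : ℂ) • (U (-t) (ψ : E), U (-t) (T ψ + ((-t : ℝ) : ℂ) • (ψ : E))) =
        (f t • U (-t) (ψ : E), f t • U (-t) (T ψ) - (t * f t) • U (-t) (ψ : E)) := by
      rw [Prod.smul_mk, (U (-t)).map_add, (U (-t)).map_smul]
      refine Prod.ext (by simp) ?_
      simp only [← Complex.coe_smul]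
      push_cast
      module
    rwa [h3] at h2
  have hI := integral_mem_of_isClosed (g := fun t => (f t • U (-t) (ψ : E),
      f t • U (-t) (T ψ) - (t * f t) • U (-t) (ψ : E))) hT
      ((hf.smul hcψ).prodMk ((hf.smul hcT).sub (hf'.smul hcψ))) ?_ hmem
  · have hInt : Integrable fun t => f t • U (-t) (T ψ) - (t * f t) • U (-t) (ψ : E) :=
      (hU.integrable_smear hf hfs _).sub (hU.integrable_smear hf' hfs' _)
    rw [integral_pair (hU.integrable_smear hf hfs _) hInt,
      integral_sub (hU.integrable_smear hf hfs _) (hU.integrable_smear hf' hfs' _)] at hI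
    exact hI
  · refine hfs.mono (fun t ht => ?_)
    simp only [Function.mem_support] at ht ⊢
    intro h0
    simp [h0] at ht

/-- The subspace of all vectors on which `A T - T A = -i`. -/
def ccrSubmodule (A T : E →ₗ.[ℂ] E) : Submodule ℂ E where
  carrier := {ψ | ∃ a b c d, (ψ, a) ∈ A.graph ∧ (ψ, b) ∈ T.graph ∧ (b, c) ∈ A.graph ∧
    (a, d) ∈ T.graph ∧ c - d = -(Complex.I • ψ)}
  zero_mem' := ⟨0, 0, 0, 0, A.graph.zero_mem, T.graph.zero_mem, A.graph.zero_mem,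
    T.graph.zero_mem, by simp⟩
  add_mem' := by
    rintro x y ⟨a, b, c, d, h1, h2, h3, h4, h5⟩ ⟨a', b', c', d', h1', h2', h3', h4', h5'⟩
    refine ⟨a + a', b + b', c + c', d + d', A.graph.add_mem h1 h1', T.graph.add_mem h2 h2',
      A.graph.add_mem h3 h3', T.graph.add_mem h4 h4', ?_⟩
    rw [add_sub_add_comm, h5, h5', smul_add, neg_add]
  smul_mem' := by
    rintro z x ⟨a, b, c, d, h1, h2, h3, h4, h5⟩
    refine ⟨z • a, z • b, z • c, z • d, A.graph.smul_mem z h1, T.graph.smul_mem z h2,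
      A.graph.smul_mem z h3, T.graph.smul_mem z h4, ?_⟩
    rw [← smul_sub, h5, smul_neg, smul_comm]

theorem isCCRDomain_ccrSubmodule (h : ccrSubmodule A T ≠ ⊥) :
    IsCCRDomain A T (ccrSubmodule A T) := by
  refine ⟨h, ?_⟩
  rintro ψ ⟨a, b, c, d, h1, h2, h3, h4, h5⟩
  obtain ⟨k1, rfl⟩ := mem_graph_iff_exists.mp h1
  obtain ⟨k2, rfl⟩ := mem_graph_iff_exists.mp h2
  obtain ⟨k3, rfl⟩ := mem_graph_iff_exists.mp h3
  obtain ⟨k4, rfl⟩ := mem_graph_iff_exists.mp h4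
  exact ⟨k1, k2, k3, k4, h5⟩

open Filter Topology in
/-- A closed strong time operator has a dense CCR-domain. -/
theorem IsStrongTimeOperator.dense_ccrSubmodule [CompleteSpace E]
    (hT : IsStrongTimeOperator A T) (hcl : T.IsClosed) :
    Dense (ccrSubmodule A T : Set E) := by
  obtain ⟨hA, hs, U, hU, h⟩ := hT
  have hmem : ∀ f : ℝ → ℝ, ContDiff ℝ 2 f → HasCompactSupport f → ∀ ψ : T.domain,
      smear U f ψ ∈ ccrSubmodule A T := by
    intro f hf hfs ψ
    have hf1 : ContDiff ℝ 1 f := hf.of_le (by norm_num)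
    have hd : Continuous (deriv f) := hf1.continuous_deriv le_rfl
    have hds : HasCompactSupport (deriv f) := hfs.deriv
    have htf : ContDiff ℝ 1 fun t => t * f t := contDiff_id.mul hf1
    have htfs : HasCompactSupport fun t => t * f t := hfs.mul_left
    have htd : Continuous fun t => t * deriv f t := by fun_prop
    have htds : HasCompactSupport fun t => t * deriv f t := hds.mul_left
    have hderiv : deriv (fun t => t * f t) = fun t => f t + t * deriv f t := by
      ext t
      have h1 : HasDerivAt f (deriv f t) t :=
        (hf1.differentiable one_ne_zero t).hasDerivAt
      have := (hasDerivAt_id t).mul h1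
      rw [one_mul] at this
      exact this.deriv
    -- Both products contain `i` times the smearing of `Tψ` by `f'`; what remains is `-i` times the
    -- smearing of `ψ` by `(t f)' - t f' = f`.
    refine ⟨_, _, _, _, hU.smear_mem_graph hf1 hfs ψ,
      hU.smear_mem_graph_time hcl h hf.continuous hfs ψ,
      A.graph.sub_mem (hU.smear_mem_graph hf1 hfs (T ψ)) (hU.smear_mem_graph htf htfs ψ),
      T.graph.smul_mem Complex.I (hU.smear_mem_graph_time hcl h hd hds ψ), ?_⟩
    rw [hderiv, hU.smear_add_fun hf.continuous hfs htd htds]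
    module
  have hsub : (T.domain : Set E) ⊆ _root_.closure (ccrSubmodule A T : Set E) := by
    intro ψ hψ
    -- Normalized bumps shrinking to `0` form an approximate identity, so the smeared vectors
    -- converge to `U 0 ψ = ψ`.
    let φ : ℕ → ContDiffBump (0 : ℝ) := fun n =>
      ⟨1 / ((n : ℝ) + 1) / 2, 1 / ((n : ℝ) + 1), by positivity,
        half_lt_self (by positivity)⟩
    have hφ : Tendsto (fun n => (φ n).rOut) atTop (𝓝 0) :=
      tendsto_one_div_add_atTop_nhds_zero_nat
    have hlim := ContDiffBump.convolution_tendsto_right_of_continuous (μ := volume) hφ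
      (hU.continuous ψ) 0
    rw [hU.map_zero] at hlim
    refine mem_closure_of_tendsto hlim (Eventually.of_forall fun n => ?_)
    rw [← TimeOperator.smear_eq_convolution]
    exact hmem _ (φ n).contDiff_normed (φ n).hasCompactSupport_normed ⟨ψ, hψ⟩
  exact dense_closure.mp (hs.1.mono hsub)

theorem IsStrongTimeOperator.exists_dense_isCCRDomain [CompleteSpace E] [Nontrivial E]
    (hT : IsStrongTimeOperator A T) (hcl : T.IsClosed) :
    ∃ D : Submodule ℂ E, IsCCRDomain A T D ∧ Dense (D : Set E) := by
  have hd := hT.dense_ccrSubmodule hcl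
  refine ⟨ccrSubmodule A T, isCCRDomain_ccrSubmodule fun h => ?_, hd⟩
  rw [h, Submodule.bot_coe] at hd
  obtain ⟨x, hx⟩ := exists_ne (0 : E)
  have := hd x
  rw [closure_singleton] at this
  exact hx this

end StrongTimeOperators

/-! ### Splitting the eigenvectors into square summable families. -/

section Decomposition

open Filter Topology in
/-- A countable set of levels with a null sequence of values can be split into infinitely many
infinite classes, such that in each class the levels are distinct and the values square summable. -/
theorem exists_partition_summable_sq {ι : Type*} [Countable ι] (π : ι → ℕ) (s : ℕ → ι)
    (hs : ∀ n, π (s n) = n) {e : ℕ → ℝ} (he : Tendsto e atTop (𝓝 0)) :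
    ∃ J : ι → ℕ, (∀ j, Infinite {p // J p = j}) ∧ (∀ p q, J p = J q → π p = π q → p = q) ∧
      ∀ j, Summable fun p : {p // J p = j} => e (π p) ^ 2 := by
  -- Along a sparse sequence of levels `k i` the squares are at most `2⁻ⁱ`. One point `σ i` on each
  -- such level is reserved to make every class infinite.
  have hev : ∀ i : ℕ, ∀ᶠ n in atTop, e n ^ 2 ≤ (1 / 2 : ℝ) ^ i := by
    intro i
    have h1 : Tendsto (fun n => e n ^ 2) atTop (𝓝 0) := by simpa using he.pow 2
    exact h1.eventually_le_const (by positivity)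
  obtain ⟨k, hk, hke⟩ := extraction_forall_of_eventually hev
  obtain ⟨c, hc⟩ := Countable.exists_injective_nat ι
  let σ : ℕ → ι := fun i => s (k i)
  have hπσ : ∀ i, π (σ i) = k i := fun i => hs _
  have hσ : Function.Injective σ := by
    intro i j hij
    have := congrArg π hij
    rw [hπσ, hπσ] at this
    exact hk.injective this
  -- The class of the reserved point on the same level as `p`, the reserved points being dealt out
  -- by the pairing function. On levels without reserved point the value is arbitrary.
  let r : ι → ℕ := fun p => (Nat.unpair (Function.invFun k (π p))).1
  have hr : ∀ i, r (σ i) = (Nat.unpair i).1 := by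
    intro i
    simp only [r, hπσ, Function.leftInverse_invFun hk.injective i]
  -- Each other point chooses a class from its own pair `{2c, 2c + 1}`, avoiding the class of the
  -- reserved point on its level. The pairs are disjoint, so a class receives at most one such
  -- point: levels stay distinct and summability is unaffected.
  let g : ι → ℕ := fun p => if 2 * c p = r p then 2 * c p + 1 else 2 * c p
  have hgr : ∀ p, g p ≠ r p := by
    intro p; simp only [g]; split_ifs with h <;> omega
  have hg : Function.Injective g := by
    intro p q hpq
    apply hc
    simp only [g] at hpq
    split_ifs at hpq <;> omega
  classical
  let J : ι → ℕ := fun p => if p ∈ Set.range σ then r p else g p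
  have hJσ : ∀ i, J (σ i) = (Nat.unpair i).1 := fun i => by
    simp only [J, Set.mem_range_self, if_true, hr]
  refine ⟨J, fun j => ?_, fun p q hJ hπ => ?_, fun j => ?_⟩
  · refine Infinite.of_injective (fun l : ℕ => (⟨σ (Nat.pair j l), by simp [hJσ]⟩ : {p // J p = j}))
      fun l l' h => ?_
    have := hσ (Subtype.ext_iff.mp h)
    simpa using this
  · have hrr : r p = r q := by simp only [r, hπ]
    simp only [J] at hJ
    split_ifs at hJ with h1 h2 h2
    · obtain ⟨i, rfl⟩ := h1
      obtain ⟨i', rfl⟩ := h2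
      rw [hπσ, hπσ] at hπ
      rw [hk.injective hπ]
    · exact absurd (hJ.symm.trans hrr) (hgr q)
    · exact absurd (hJ.trans hrr.symm) (hgr p)
    · exact hg hJ
  · let f : ι → ℝ := fun p => e (π p) ^ 2
    have hF : Summable ((Set.range σ).indicator f) := by
      rw [← hσ.summable_iff (fun x hx => Set.indicator_of_notMem hx _)]
      refine Summable.of_nonneg_of_le (fun i => ?_) (fun i => ?_) summable_geometric_two
      · exact Set.indicator_nonneg (fun _ _ => sq_nonneg _) _
      · simp only [Function.comp_apply, Set.indicator_of_mem (Set.mem_range_self i), f, hπσ]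
        exact hke i
    have hfin : ({p | J p = j} \ Set.range σ).Finite := by
      refine Set.Subsingleton.finite fun p hp q hq => ?_
      apply hg
      have h1 : J p = g p := if_neg hp.2
      have h2 : J q = g q := if_neg hq.2
      rw [← h1, ← h2, hp.1, hq.1]
    have hF' : Summable (({p | J p = j} \ Set.range σ).indicator f) :=
      summable_of_hasFiniteSupport (hfin.subset Set.support_indicator_subset)
    refine ((hF.add hF').subtype {p | J p = j}).congr fun p => ?_
    obtain ⟨p, hp⟩ := p
    simp only [Function.comp_apply]
    by_cases h : p ∈ Set.range σ
    · rw [Set.indicator_of_mem h, Set.indicator_of_notMem (fun h' => h'.2 h), add_zero]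
    · rw [Set.indicator_of_notMem h, Set.indicator_of_mem
        (show p ∈ {p | J p = j} \ Set.range σ from ⟨hp, h⟩), zero_add]

variable {E : Type*} [NormedAddCommGroup E] [InnerProductSpace ℂ E]

open Filter Topology in
-- Orthonormal bases of the finite-dimensional eigenspaces together form an orthonormal family, as
-- eigenvectors for distinct eigenvalues are orthogonal; `exists_partition_summable_sq` regroups it.
theorem nonempty_eigenDecomposition {H : E →ₗ.[ℂ] E} (hH : H.IsFormalAdjoint H)
    {e : ℕ → ℝ} (hp : pointSpectrum H = Set.range fun n => (e n : ℂ))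
    (hinj : Function.Injective e) (he : Tendsto e atTop (𝓝 0))
    (hfin : ∀ n, FiniteDimensional ℂ (eigenspace H (e n))) :
    Nonempty (EigenDecomposition H) := by
  have hne : ∀ n, eigenspace H (e n) ≠ ⊥ := by
    intro n
    have : (e n : ℂ) ∈ pointSpectrum H := by rw [hp]; exact ⟨n, rfl⟩
    exact this
  let b : ∀ n, OrthonormalBasis (Fin (Module.finrank ℂ (eigenspace H (e n)))) ℂ
    (eigenspace H (e n)) := fun n => stdOrthonormalBasis ℂ _
  have hpos : ∀ n, 0 < Module.finrank ℂ (eigenspace H (e n)) := by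
    intro n
    rw [Module.finrank_pos_iff]
    exact Submodule.nontrivial_iff_ne_bot.mpr (hne n)
  let ι := Σ n, Fin (Module.finrank ℂ (eigenspace H (e n)))
  let v : ι → E := fun p => (b p.1 p.2 : E)
  have hv : ∀ p : ι, v p ∈ eigenspace H (e p.1) := fun p => (b p.1 p.2).2
  have hvo : Orthonormal ℂ v := by
    rw [orthonormal_iff_ite]
    rintro ⟨n, i⟩ ⟨m, k⟩
    by_cases hnm : n = m
    · subst hnm
      have := orthonormal_iff_ite.mp (b n).orthonormal i k
      rw [Submodule.coe_inner] at this
      by_cases hik : i = k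
      · subst hik; simpa [v] using this
      · rw [if_neg hik] at this
        have hne' : (⟨n, i⟩ : ι) ≠ ⟨n, k⟩ := fun h => hik (by simpa [ι] using h)
        rw [if_neg hne']
        exact this
    · rw [if_neg (fun h => hnm (congrArg Sigma.fst h))]
      exact inner_eigenvector_eq_zero hH (hv ⟨n, i⟩) (hv ⟨m, k⟩)
        (fun h => hnm (hinj (Complex.ofReal_injective h)))
  have hspan : Submodule.span ℂ (Set.range v) = ⨆ z : ℂ, eigenspace H z := by
    apply le_antisymm
    · rw [Submodule.span_le]
      rintro _ ⟨p, rfl⟩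
      exact Submodule.mem_iSup_of_mem _ (hv p)
    · refine iSup_le fun z => ?_
      by_cases hz : eigenspace H z = ⊥
      · rw [hz]; exact bot_le
      have hz' : z ∈ pointSpectrum H := hz
      rw [hp] at hz'
      obtain ⟨n, rfl⟩ := hz'
      intro x hx
      have h1 := (b n).sum_repr ⟨x, hx⟩
      have h2 := congrArg (Submodule.subtype _) h1
      simp only [map_sum, map_smul, Submodule.subtype_apply] at h2
      rw [← h2]
      exact Submodule.sum_mem _ fun i _ => Submodule.smul_mem _ _
        (Submodule.subset_span ⟨⟨n, i⟩, rfl⟩)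
  obtain ⟨J, hJ1, hJ2, hJ3⟩ := exists_partition_summable_sq (ι := ι) (fun p => p.1)
    (fun n => ⟨n, ⟨0, hpos n⟩⟩) (fun n => rfl) he
  have hequiv : ∀ j, Nonempty (ℕ ≃ {p // J p = j}) := fun j =>
    have := hJ1 j
    nonempty_equiv_of_countable
  let ε : ∀ j, ℕ ≃ {p // J p = j} := fun j => (hequiv j).some
  let m : {j : ℕ // (j : ℕ∞) < ⊤} × ℕ → ι := fun q => (ε q.1 q.2 : ι)
  have hm : Function.Injective m := by
    rintro ⟨⟨j, hj⟩, n⟩ ⟨⟨j', hj'⟩, n'⟩ h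
    have h1 : j = j' := by
      have h1 := (ε j n).2
      have h2 := (ε j' n').2
      rw [← h1, ← h2]
      exact congrArg J h
    subst h1
    have h2 : ε j n = ε j n' := Subtype.ext h
    rw [(ε j).injective h2]
  have hms : Function.Surjective m := by
    intro p
    refine ⟨⟨⟨J p, ENat.natCast_lt_top _⟩, (ε (J p)).symm ⟨p, rfl⟩⟩, ?_⟩
    simp [m]
  exact ⟨{
    -- Every natural number labels an infinite class, so infinitely many families arise whatever the
    -- multiplicities are.
    N := ⊤
    vec := fun j n => v (ε j n)
    val := fun j n => e (ε j n : ι).1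
    orthonormal := hvo.comp m hm
    eigen := fun j n => hv _
    injective := fun j n n' h => by
      have h1 := hinj h
      have h2 := hJ2 _ _ ((ε j n).2.trans (ε j n').2.symm) h1
      exact (ε j).injective (Subtype.ext h2)
    summable := fun j => (ε j).summable_iff.mpr (hJ3 j)
    span_eq := by
      have : Set.range (fun p : {j : ℕ // (j : ℕ∞) < ⊤} × ℕ => v (ε p.1 p.2)) = Set.range v :=
        hms.range_comp v
      rw [this, hspan]
      rfl }⟩

end Decomposition

/-! ### The form `t_p` as a matrix in the eigenbasis. -/

section PointForm

variable {E : Type*} [NormedAddCommGroup E] [InnerProductSpace ℂ E]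

theorem value_inverse_of_mem_graph {H : E →ₗ.[ℂ] E} (hk : LinearMap.ker H.toFun = ⊥) {x y : E}
    (h : (x, y) ∈ H.graph) : value H.inverse y = x := by
  obtain ⟨hx, rfl⟩ := mem_graph_iff_exists.mp h
  have hy : H ⟨x, hx⟩ ∈ H.inverse.domain := by
    rw [LinearPMap.inverse_domain]; exact ⟨⟨x, hx⟩, rfl⟩
  rw [value_of_mem hy]
  exact LinearPMap.inverse_apply_eq hk (y := ⟨_, hy⟩) (x := ⟨x, hx⟩) rfl

theorem eq_of_mem_graph_of_ker_eq_bot {H : E →ₗ.[ℂ] E} (hk : LinearMap.ker H.toFun = ⊥)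
    {x x' y : E} (h : (x, y) ∈ H.graph) (h' : (x', y) ∈ H.graph) : x = x' := by
  rw [← value_inverse_of_mem_graph hk h, value_inverse_of_mem_graph hk h']

namespace EigenDecomposition

variable {H : E →ₗ.[ℂ] E} (d : EigenDecomposition H)

/-- The basis vectors `e_n^j`. -/
def bvec (p : d.Idx × ℕ) : E := d.vec p.1 p.2

/-- The eigenvalues `F_{jn}`. -/
def bval (p : d.Idx × ℕ) : ℂ := (d.val p.1 p.2 : ℂ)

/-- The linear combination `∑ c_p w_p e_p` with weights `w`. -/
def comb (w : d.Idx × ℕ → ℂ) : (d.Idx × ℕ →₀ ℂ) →ₗ[ℂ] E :=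
  Finsupp.linearCombination ℂ fun p => w p • d.bvec p

theorem comb_apply (w : d.Idx × ℕ → ℂ) (c : d.Idx × ℕ →₀ ℂ) :
    d.comb w c = ∑ p ∈ c.support, c p • w p • d.bvec p :=
  Finsupp.linearCombination_apply ℂ c

theorem inner_bvec (p q : d.Idx × ℕ) : inner ℂ (d.bvec p) (d.bvec q) = if p = q then 1 else 0 :=
  orthonormal_iff_ite.mp d.orthonormal p q

theorem inner_bvec_comb (w : d.Idx × ℕ → ℂ) (c : d.Idx × ℕ →₀ ℂ) (p : d.Idx × ℕ) :
    inner ℂ (d.bvec p) (d.comb w c) = c p * w p := by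
  rw [comb_apply, inner_sum]
  simp only [inner_smul_right, inner_bvec, mul_ite, mul_one, mul_zero]
  rw [Finset.sum_ite_eq]
  split_ifs with h
  · rfl
  · rw [Finsupp.notMem_support_iff.mp h, zero_mul]

theorem bvec_mem_graph (p : d.Idx × ℕ) : (d.bvec p, d.bval p • d.bvec p) ∈ H.graph :=
  mem_graph_iff_exists.mpr (mem_eigenspace_iff.mp (d.eigen p.1 p.2))

theorem comb_mem_graph (w : d.Idx × ℕ → ℂ) (c : d.Idx × ℕ →₀ ℂ) :
    (d.comb w c, d.comb (fun p => w p * d.bval p) c) ∈ H.graph := by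
  have h : (d.comb w c, d.comb (fun p => w p * d.bval p) c) =
      ∑ p ∈ c.support, (c p * w p) • (d.bvec p, d.bval p • d.bvec p) := by
    rw [comb_apply, comb_apply]
    refine Prod.ext ?_ ?_
    · simp [Prod.fst_sum, smul_smul]
    · simp [Prod.snd_sum, smul_smul, mul_assoc]
  rw [h]
  exact Submodule.sum_mem _ fun p _ => H.graph.smul_mem _ (d.bvec_mem_graph p)

theorem bvec_ne_zero (p : d.Idx × ℕ) : d.bvec p ≠ 0 := by
  intro h
  have := d.inner_bvec p p
  rw [h, inner_zero_left, if_pos rfl] at this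
  exact zero_ne_one this

theorem bval_ne_zero (hk : LinearMap.ker H.toFun = ⊥) (p : d.Idx × ℕ) : d.bval p ≠ 0 := by
  intro h
  have h1 := d.bvec_mem_graph p
  rw [h, zero_smul] at h1
  exact d.bvec_ne_zero p (eq_of_mem_graph_of_ker_eq_bot hk h1 H.graph.zero_mem)

theorem value_inverse_comb (hk : LinearMap.ker H.toFun = ⊥) (w : d.Idx × ℕ → ℂ)
    (c : d.Idx × ℕ →₀ ℂ) :
    value H.inverse (d.comb w c) = d.comb (fun p => w p / d.bval p) c := by
  refine value_inverse_of_mem_graph hk ?_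
  have := d.comb_mem_graph (fun p => w p / d.bval p) c
  simpa only [div_mul_cancel₀ _ (d.bval_ne_zero hk _)] using this

theorem invSq_comb (hk : LinearMap.ker H.toFun = ⊥) (w : d.Idx × ℕ → ℂ) (c : d.Idx × ℕ →₀ ℂ) :
    invSq H (d.comb w c) = d.comb (fun p => w p * (1 / d.bval p) ^ 2) c := by
  rw [invSq, value_inverse_comb d hk, value_inverse_comb d hk]
  congr 1
  ext p
  ring_nf

theorem bvec_eq_comb (p : d.Idx × ℕ) : d.bvec p = d.comb 1 (Finsupp.single p 1) := by
  simp [comb]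

theorem domP_eq_range : d.domP = LinearMap.range (d.comb 1) := by
  rw [comb, Finsupp.range_linearCombination]
  simp only [Pi.one_apply, one_smul]
  apply le_antisymm
  · refine iSup_le fun j => Submodule.span_mono ?_
    rintro _ ⟨n, rfl⟩
    exact ⟨(j, n), rfl⟩
  · rw [Submodule.span_le]
    rintro _ ⟨p, rfl⟩
    exact Submodule.mem_iSup_of_mem p.1 (Submodule.subset_span ⟨p.2, rfl⟩)

theorem bvec_mem_domP (p : d.Idx × ℕ) : d.bvec p ∈ d.domP := by
  rw [domP_eq_range, bvec_eq_comb]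
  exact ⟨_, rfl⟩

theorem comb_mem_domP (w : d.Idx × ℕ → ℂ) (c : d.Idx × ℕ →₀ ℂ) : d.comb w c ∈ d.domP := by
  rw [comb_apply]
  exact Submodule.sum_mem _ fun p _ =>
    Submodule.smul_mem _ _ (Submodule.smul_mem _ _ (d.bvec_mem_domP p))

theorem exists_comb_of_mem_domP {φ : E} (h : φ ∈ d.domP) : ∃ c, d.comb 1 c = φ := by
  rw [domP_eq_range] at h
  exact h

theorem domP_le_ppSubspace : d.domP ≤ ppSubspace H := by
  refine le_trans (iSup_le fun j => ?_) (Submodule.le_topologicalClosure _)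
  rw [domS, Submodule.span_le]
  rintro _ ⟨n, rfl⟩
  exact Submodule.mem_iSup_of_mem _ (d.eigen j n)

theorem starProjection_comb [CompleteSpace E] (j : d.Idx) (w : d.Idx × ℕ → ℂ)
    (c : d.Idx × ℕ →₀ ℂ) :
    (d.space j).starProjection (d.comb w c) = d.comb (fun p => if p.1 = j then w p else 0) c := by
  have hb : ∀ p : d.Idx × ℕ,
      (d.space j).starProjection (d.bvec p) = if p.1 = j then d.bvec p else 0 := by
    intro p
    split_ifs with h
    · rw [Submodule.starProjection_eq_self_iff]
      subst h
      exact Submodule.le_topologicalClosure _ (Submodule.subset_span ⟨p.2, rfl⟩)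
    · rw [Submodule.starProjection_apply_eq_zero_iff, space, Submodule.orthogonal_closure, domS,
        Submodule.mem_orthogonal]
      intro u hu
      induction hu using Submodule.span_induction with
      | mem x hx =>
        obtain ⟨n, rfl⟩ := hx
        have := d.inner_bvec (j, n) p
        rwa [if_neg (fun h' => h (by rw [← h']))] at this
      | zero => exact inner_zero_left _
      | add x y _ _ hx hy => rw [inner_add_left, hx, hy, add_zero]
      | smul a x _ hx => rw [inner_smul_left, hx, mul_zero]
  rw [comb_apply, comb_apply, map_sum]
  refine Finset.sum_congr rfl fun p _ => ?_
  rw [map_smul, map_smul, hb]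
  split_ifs <;> simp

open Filter Topology in
theorem tendsto_val (j : d.Idx) : Tendsto (d.val j) atTop (𝓝 0) := by
  have h := (d.summable j).tendsto_atTop_zero.sqrt
  simp only [Real.sqrt_sq_eq_abs, Real.sqrt_zero] at h
  exact (tendsto_zero_iff_abs_tendsto_zero _).mpr h

theorem summable_smul_vec [CompleteSpace E] (j : d.Idx) {a : ℕ → ℂ}
    (ha : Summable fun n => ‖a n‖ ^ 2) :
    Summable fun n => a n • d.vec j n := by
  classical
  have ho : Orthonormal ℂ (d.vec j) :=
    d.orthonormal.comp (fun n : ℕ => (j, n)) (fun n m h => (Prod.ext_iff.mp h).2)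
  exact (ho.orthogonalFamily.summable_iff_norm_sq_summable a).mpr ha

open Filter Topology in
-- The quotient equals `F_n F_m / (F_m - F_n)`, which is at most `2|F_n|` in modulus once `|F_n| <
-- |F_m|/2`. Square summability of the eigenvalues therefore makes the series defining `S_j`
-- converge in norm.
theorem summable_norm_sq_inv_sub (hk : LinearMap.ker H.toFun = ⊥) (j : d.Idx) (m : ℕ) :
    Summable fun n => ‖1 / (1 / d.bval (j, n) - 1 / d.bval (j, m))‖ ^ 2 := by
  have hm : d.val j m ≠ 0 := fun h => d.bval_ne_zero hk (j, m) (by simp [bval, h])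
  have hm' : 0 < |d.val j m| := abs_pos.mpr hm
  have hev : ∀ᶠ n in atTop, |d.val j n| < |d.val j m| / 2 := by
    have := (tendsto_zero_iff_abs_tendsto_zero _).mp (d.tendsto_val j)
    exact this.eventually_lt_const (by positivity)
  refine Summable.of_norm_bounded_eventually_nat ((d.summable j).mul_left 4) ?_
  filter_upwards [hev] with n hn
  have hn0 : d.val j n ≠ 0 := fun h => d.bval_ne_zero hk (j, n) (by simp [bval, h])
  have h1 : |d.val j m| / 2 ≤ |d.val j m - d.val j n| := by
    have := abs_sub_abs_le_abs_sub (d.val j m) (d.val j n)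
    linarith
  have hpos : 0 < |d.val j m - d.val j n| := lt_of_lt_of_le (by positivity) h1
  have h2 : 1 / (1 / d.bval (j, n) - 1 / d.bval (j, m)) =
      ((d.val j n * d.val j m / (d.val j m - d.val j n) : ℝ) : ℂ) := by
    have h3 : d.val j m - d.val j n ≠ 0 := abs_pos.mp hpos
    have h4 : (d.val j m : ℂ) - d.val j n ≠ 0 := by exact_mod_cast h3
    have h5 : (d.val j m : ℂ) ≠ 0 := by exact_mod_cast hm
    have h6 : (d.val j n : ℂ) ≠ 0 := by exact_mod_cast hn0
    simp only [bval]
    push_cast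
    rw [div_sub_div _ _ h6 h5]
    simp
  have h3 : |d.val j n * d.val j m / (d.val j m - d.val j n)| ≤ 2 * |d.val j n| := by
    rw [abs_div, abs_mul, div_le_iff₀ hpos]
    nlinarith [abs_nonneg (d.val j n)]
  rw [Real.norm_of_nonneg (sq_nonneg _), h2, Complex.norm_real, Real.norm_eq_abs]
  calc |d.val j n * d.val j m / (d.val j m - d.val j n)| ^ 2 ≤ (2 * |d.val j n|) ^ 2 := by
        gcongr
    _ = 4 * d.val j n ^ 2 := by rw [mul_pow, sq_abs]; norm_num

theorem inner_vec_opS [CompleteSpace E] (hk : LinearMap.ker H.toFun = ⊥) (j : d.Idx)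
    (w : d.Idx × ℕ → ℂ) (c : d.Idx × ℕ →₀ ℂ) (k : ℕ) :
    inner ℂ (d.vec j k) (d.opS j (d.comb w c)) = ∑ p ∈ c.support, if p.1 = j then
      c p * w p * (Complex.I / (1 / d.bval (j, k) - 1 / d.bval p)) else 0 := by
  classical
  let M : Finset ℕ := c.support.image Prod.snd
  have hM : ∀ m ∉ M, c (j, m) = 0 := by
    intro m hm
    by_contra h
    exact hm (Finset.mem_image.mpr ⟨(j, m), Finsupp.mem_support_iff.mpr h, rfl⟩)
  let a : ℕ → ℂ := fun n => ∑ m ∈ M, c (j, m) * w (j, m) *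
    (1 / (1 / d.bval (j, n) - 1 / d.bval (j, m)))
  have ha : ∀ n, (∑' m, if m = n then 0 else inner ℂ (d.vec j m) (d.comb w c) /
      (1 / (d.val j n : ℂ) - 1 / (d.val j m : ℂ))) = a n := by
    intro n
    have h1 : ∀ m, (if m = n then 0 else inner ℂ (d.vec j m) (d.comb w c) /
        (1 / (d.val j n : ℂ) - 1 / (d.val j m : ℂ))) = c (j, m) * w (j, m) *
          (1 / (1 / d.bval (j, n) - 1 / d.bval (j, m))) := by
      intro m
      split_ifs with h
      -- The omitted diagonal term agrees with the general one because `1 / 0 = 0`; no case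
      -- distinction is needed from here on.
      · simp [h]
      · rw [show d.vec j m = d.bvec (j, m) from rfl, inner_bvec_comb, mul_one_div]
        rfl
    simp only [h1]
    exact tsum_eq_sum fun m hm => by rw [hM m hm]; ring
  have hsum : Summable fun n => a n • d.vec j n := by
    simp only [a, Finset.sum_smul, mul_smul]
    refine summable_sum fun m _ => Summable.const_smul _ (Summable.const_smul _ ?_)
    exact d.summable_smul_vec j (d.summable_norm_sq_inv_sub hk j m)
  have hinner : inner ℂ (d.vec j k) (∑' n, a n • d.vec j n) = a k := by
    have h1 := (innerSL ℂ (d.vec j k)).map_tsum hsum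
    simp only [innerSL_apply_apply] at h1
    rw [h1, tsum_eq_single k]
    · rw [inner_smul_right, show d.vec j k = d.bvec (j, k) from rfl, inner_bvec, if_pos rfl,
        mul_one]
    · intro n hn
      have := d.inner_bvec (j, k) (j, n)
      rw [if_neg (by simpa using hn.symm)] at this
      rw [inner_smul_right]
      change a n * inner ℂ (d.bvec (j, k)) (d.bvec (j, n)) = 0
      rw [this, mul_zero]
  rw [opS]
  simp only [ha]
  rw [inner_smul_right, hinner, ← Finset.sum_filter]
  have hsub : c.support.filter (fun p => p.1 = j) ⊆ {j} ×ˢ M := by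
    intro p hp
    rw [Finset.mem_filter] at hp
    rw [Finset.mem_product, Finset.mem_singleton]
    exact ⟨hp.2, Finset.mem_image_of_mem _ hp.1⟩
  rw [Finset.sum_subset hsub]
  · rw [Finset.sum_product, Finset.sum_singleton, Finset.mul_sum]
    refine Finset.sum_congr rfl fun m _ => ?_
    ring
  · intro p hp hp'
    have hp1 : p.1 = j := by
      rw [Finset.mem_product, Finset.mem_singleton] at hp; exact hp.1
    have : c p = 0 := by
      by_contra h
      exact hp' (Finset.mem_filter.mpr ⟨Finsupp.mem_support_iff.mpr h, hp1⟩)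
    rw [this, zero_mul, zero_mul]

/-- The matrix of the form `t_p` in the basis `e_n^j`. -/
def coeff (p q : d.Idx × ℕ) : ℂ :=
  if p.1 = q.1 then -(1 / 2) * ((1 / d.bval p) ^ 2 + (1 / d.bval q) ^ 2) *
    (Complex.I / (1 / d.bval p - 1 / d.bval q)) else 0

/-- The sesquilinear form with matrix `m`. -/
def matrixForm (m : d.Idx × ℕ → d.Idx × ℕ → ℂ) (c c' : d.Idx × ℕ →₀ ℂ) : ℂ :=
  ∑ p ∈ c.support, ∑ q ∈ c'.support, conj (c p) * c' q * m p q

theorem conj_bval (p : d.Idx × ℕ) : conj (d.bval p) = d.bval p := Complex.conj_ofReal _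

/-- A real symmetric factor times `i` times a real antisymmetric factor is Hermitian. -/
theorem conj_coeff (p q : d.Idx × ℕ) : conj (d.coeff p q) = d.coeff q p := by
  unfold coeff
  by_cases h : p.1 = q.1
  · rw [if_pos h, if_pos h.symm]
    simp only [map_mul, map_neg, map_add, map_sub, map_div₀, map_pow, map_one, conj_bval,
      Complex.conj_I, map_ofNat]
    rw [← neg_sub (1 / d.bval q), neg_div_neg_eq, add_comm]
  · rw [if_neg h, if_neg (fun h' => h h'.symm), map_zero]

theorem inner_comb_right (w : d.Idx × ℕ → ℂ) (c : d.Idx × ℕ →₀ ℂ) (x : E) :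
    inner ℂ x (d.comb w c) = ∑ p ∈ c.support, c p * w p * inner ℂ x (d.bvec p) := by
  rw [comb_apply, inner_sum]
  refine Finset.sum_congr rfl fun p _ => ?_
  rw [inner_smul_right, inner_smul_right, mul_assoc]

theorem inner_comb_left (w : d.Idx × ℕ → ℂ) (c : d.Idx × ℕ →₀ ℂ) (x : E) :
    inner ℂ (d.comb w c) x = ∑ p ∈ c.support, conj (c p * w p) * inner ℂ (d.bvec p) x := by
  rw [comb_apply, sum_inner]
  refine Finset.sum_congr rfl fun p _ => ?_
  rw [inner_smul_left, inner_smul_left, map_mul, mul_assoc]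

theorem formJ_comb [CompleteSpace E] (hk : LinearMap.ker H.toFun = ⊥) (j : d.Idx)
    (w w' : d.Idx × ℕ → ℂ)
    (c c' : d.Idx × ℕ →₀ ℂ) :
    d.formJ j (d.comb (fun p => if p.1 = j then w p else 0) c)
      (d.comb (fun p => if p.1 = j then w' p else 0) c') =
    d.matrixForm (fun p q => if p.1 = j ∧ q.1 = j then conj (w p) * w' q * d.coeff p q else 0)
      c c' := by
  have h1 : inner ℂ (d.opS j (d.comb (fun p => if p.1 = j then w p else 0) c))
      (invSq H (d.comb (fun p => if p.1 = j then w' p else 0) c')) =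
      ∑ p ∈ c.support, ∑ q ∈ c'.support, if p.1 = j ∧ q.1 = j then conj (c p) * c' q *
        (conj (w p) * w' q * ((1 / d.bval q) ^ 2 *
          (Complex.I / (1 / d.bval p - 1 / d.bval q)))) else 0 := by
    rw [invSq_comb d hk, inner_comb_right, Finset.sum_comm]
    refine Finset.sum_congr rfl fun q _ => ?_
    by_cases hq : q.1 = j
    · have hq' : d.bvec q = d.vec j q.2 := by rw [← hq]; rfl
      have hq'' : (j, q.2) = q := by rw [← hq]
      rw [hq', ← inner_conj_symm, inner_vec_opS d hk, hq'', map_sum, Finset.mul_sum]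
      refine Finset.sum_congr rfl fun p _ => ?_
      by_cases hp : p.1 = j
      · simp only [hp, hq, if_true, and_self, map_mul, map_div₀, map_sub, map_one, conj_bval,
          Complex.conj_I]
        rw [← neg_sub (1 / d.bval p), neg_div_neg_eq]
        ring
      · simp [hp]
    · simp [hq]
  have h2 : inner ℂ (invSq H (d.comb (fun p => if p.1 = j then w p else 0) c))
      (d.opS j (d.comb (fun p => if p.1 = j then w' p else 0) c')) =
      ∑ p ∈ c.support, ∑ q ∈ c'.support, if p.1 = j ∧ q.1 = j then conj (c p) * c' q *
        (conj (w p) * w' q * ((1 / d.bval p) ^ 2 *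
          (Complex.I / (1 / d.bval p - 1 / d.bval q)))) else 0 := by
    rw [invSq_comb d hk, inner_comb_left]
    refine Finset.sum_congr rfl fun p _ => ?_
    by_cases hp : p.1 = j
    · have hp' : d.bvec p = d.vec j p.2 := by rw [← hp]; rfl
      have hp'' : (j, p.2) = p := by rw [← hp]
      rw [hp', inner_vec_opS d hk, hp'', Finset.mul_sum]
      refine Finset.sum_congr rfl fun q _ => ?_
      by_cases hq : q.1 = j
      · simp only [hp, hq, if_true, and_self, map_mul, map_div₀, map_pow, map_one, conj_bval]
        ring
      · simp [hq]
    · simp [hp]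
  rw [formJ, h1, h2, matrixForm, ← Finset.sum_add_distrib, Finset.mul_sum]
  refine Finset.sum_congr rfl fun p _ => ?_
  rw [← Finset.sum_add_distrib, Finset.mul_sum]
  refine Finset.sum_congr rfl fun q _ => ?_
  by_cases h : p.1 = j ∧ q.1 = j
  · rw [if_pos h, if_pos h, if_pos h, coeff, if_pos (h.1.trans h.2.symm)]
    ring
  · rw [if_neg h, if_neg h, if_neg h]
    ring

/-- The projections cut the matrix into blocks, one for each class, and the sum over `j` reassembles
them. The weights are kept general so that vectors of `𝓔_p` and their images under powers of `H` are
covered at once. -/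
theorem formP_comb [CompleteSpace E] (hk : LinearMap.ker H.toFun = ⊥) (w w' : d.Idx × ℕ → ℂ)
    (c c' : d.Idx × ℕ →₀ ℂ) :
    d.formP (d.comb w c) (d.comb w' c') =
      d.matrixForm (fun p q => conj (w p) * w' q * d.coeff p q) c c' := by
  classical
  simp only [formP, starProjection_comb, formJ_comb d hk]
  rw [finsum_eq_sum_of_support_subset (s := c.support.image Prod.fst)]
  · simp only [matrixForm]
    rw [Finset.sum_comm]
    refine Finset.sum_congr rfl fun p hp => ?_
    rw [Finset.sum_comm]
    refine Finset.sum_congr rfl fun q _ => ?_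
    rw [Finset.sum_eq_single p.1]
    · by_cases h : q.1 = p.1
      · simp [h]
      · have h0 : d.coeff p q = 0 := if_neg (fun h' => h h'.symm)
        simp [h0]
    · intro j _ hj
      rw [if_neg (fun h => hj h.1.symm), mul_zero]
    · intro h
      exact absurd (Finset.mem_image_of_mem _ hp) h
  · intro j hj
    by_contra h
    apply hj
    refine Finset.sum_eq_zero fun p hp => Finset.sum_eq_zero fun q _ => ?_
    have hpj : ¬(p.1 = j ∧ q.1 = j) := by
      rintro ⟨rfl, _⟩
      exact h (Finset.mem_coe.mpr (Finset.mem_image_of_mem _ hp))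
    simp only [if_neg hpj, mul_zero]

end EigenDecomposition

end PointForm

/-! ### The commutation relation on the point part. -/

section PointCCR

variable {E : Type*} [NormedAddCommGroup E] [InnerProductSpace ℂ E]

namespace EigenDecomposition

variable {H : E →ₗ.[ℂ] E} (d : EigenDecomposition H)

theorem matrixForm_eq_sum (m : d.Idx × ℕ → d.Idx × ℕ → ℂ) (c c' : d.Idx × ℕ →₀ ℂ)
    {s s' : Finset (d.Idx × ℕ)} (hs : c.support ⊆ s) (hs' : c'.support ⊆ s') :
    d.matrixForm m c c' = ∑ p ∈ s, ∑ q ∈ s', conj (c p) * c' q * m p q := by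
  rw [matrixForm]
  have h1 : ∀ p, ∑ q ∈ c'.support, conj (c p) * c' q * m p q =
      ∑ q ∈ s', conj (c p) * c' q * m p q := fun p =>
    Finset.sum_subset hs' fun q _ hq => by rw [Finsupp.notMem_support_iff.mp hq]; ring
  simp only [h1]
  exact Finset.sum_subset hs fun p _ hp => by
    simp [Finsupp.notMem_support_iff.mp hp]

theorem matrixForm_add_left (m : d.Idx × ℕ → d.Idx × ℕ → ℂ) (c₁ c₂ c' : d.Idx × ℕ →₀ ℂ) :
    d.matrixForm m (c₁ + c₂) c' = d.matrixForm m c₁ c' + d.matrixForm m c₂ c' := by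
  classical
  rw [d.matrixForm_eq_sum m _ _ Finsupp.support_add subset_rfl,
    d.matrixForm_eq_sum m c₁ _ (Finset.subset_union_left (s₂ := c₂.support)) subset_rfl,
    d.matrixForm_eq_sum m c₂ _ (Finset.subset_union_right (s₁ := c₁.support)) subset_rfl,
    ← Finset.sum_add_distrib]
  refine Finset.sum_congr rfl fun p _ => ?_
  rw [← Finset.sum_add_distrib]
  refine Finset.sum_congr rfl fun q _ => ?_
  rw [Finsupp.add_apply, map_add]
  ring

theorem matrixForm_smul_left (m : d.Idx × ℕ → d.Idx × ℕ → ℂ) (a : ℂ) (c c' : d.Idx × ℕ →₀ ℂ) :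
    d.matrixForm m (a • c) c' = conj a * d.matrixForm m c c' := by
  rw [d.matrixForm_eq_sum m _ _ Finsupp.support_smul subset_rfl, matrixForm, Finset.mul_sum]
  refine Finset.sum_congr rfl fun p _ => ?_
  rw [Finset.mul_sum]
  refine Finset.sum_congr rfl fun q _ => ?_
  rw [Finsupp.smul_apply, smul_eq_mul, map_mul]
  ring

theorem conj_matrixForm (m : d.Idx × ℕ → d.Idx × ℕ → ℂ) (c c' : d.Idx × ℕ →₀ ℂ) :
    conj (d.matrixForm m c c') = d.matrixForm (fun p q => conj (m q p)) c' c := by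
  simp only [matrixForm, map_sum]
  rw [Finset.sum_comm]
  refine Finset.sum_congr rfl fun p _ => Finset.sum_congr rfl fun q _ => ?_
  simp only [map_mul, Complex.conj_conj]
  ring

theorem inner_comb_comb (w w' : d.Idx × ℕ → ℂ) (c c' : d.Idx × ℕ →₀ ℂ) :
    inner ℂ (d.comb w c) (d.comb w' c') =
      d.matrixForm (fun p q => conj (w p) * w' q * if p = q then 1 else 0) c c' := by
  rw [inner_comb_left, matrixForm]
  refine Finset.sum_congr rfl fun p _ => ?_
  rw [inner_comb_right, Finset.mul_sum]
  refine Finset.sum_congr rfl fun q _ => ?_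
  rw [inner_bvec, map_mul]
  ring

/-- Coefficients whose sum over each class `j` vanishes. -/
def zeroSum : Submodule ℂ (d.Idx × ℕ →₀ ℂ) :=
  ⨅ j, LinearMap.ker (Finsupp.linearCombination ℂ
    fun p : d.Idx × ℕ => if p.1 = j then (1 : ℂ) else 0)

theorem sum_eq_zero_of_mem_zeroSum {c : d.Idx × ℕ →₀ ℂ} (hc : c ∈ d.zeroSum) (j : d.Idx) :
    ∑ p ∈ c.support, (if p.1 = j then c p else 0) = 0 := by
  have h := (Submodule.mem_iInf _).mp hc j
  rw [LinearMap.mem_ker, Finsupp.linearCombination_apply, Finsupp.sum] at h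
  simpa using h

theorem exists_zeroSum_of_mem_ccrP {x : E} (hx : x ∈ d.ccrP) :
    ∃ c ∈ d.zeroSum, d.comb 1 c = x := by
  have h : d.ccrP ≤ d.zeroSum.map (d.comb 1) := by
    refine iSup_le fun j => Submodule.span_le.mpr ?_
    rintro _ ⟨n, m, rfl⟩
    refine ⟨Finsupp.single (j, n) 1 - Finsupp.single (j, m) 1, ?_, ?_⟩
    · refine (Submodule.mem_iInf _).mpr fun k => ?_
      rw [LinearMap.mem_ker, map_sub]
      simp
    · rw [map_sub, ← bvec_eq_comb, ← bvec_eq_comb]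
      rfl
  exact h hx

theorem sub_mem_ccrP (j : d.Idx) (n m : ℕ) : d.bvec (j, n) - d.bvec (j, m) ∈ d.ccrP :=
  Submodule.mem_iSup_of_mem j (Submodule.subset_span ⟨n, m, rfl⟩)

theorem exists_zeroSum_of_mem_mapCcrP {x : E} (hx : x ∈ d.mapCcrP) :
    ∃ c ∈ d.zeroSum, d.comb d.bval c = x := by
  obtain ⟨⟨y, hyd⟩, hy, rfl⟩ := hx
  obtain ⟨c, hc, rfl⟩ := d.exists_zeroSum_of_mem_ccrP hy
  refine ⟨c, hc, ?_⟩
  obtain ⟨h1, h2⟩ := mem_graph_iff_exists.mp (d.comb_mem_graph 1 c)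
  simp only [Pi.one_apply, one_mul] at h2
  exact h2.symm

theorem exists_zeroSum_of_mem_invCcrP (hk : LinearMap.ker H.toFun = ⊥) {x : E}
    (hx : x ∈ d.invCcrP) : ∃ c ∈ d.zeroSum, d.comb (fun p => 1 / d.bval p) c = x := by
  obtain ⟨⟨⟨x, hxd⟩, hx', rfl⟩, -⟩ := hx
  obtain ⟨c, hc, hc'⟩ := d.exists_zeroSum_of_mem_ccrP hx'
  refine ⟨c, hc, ?_⟩
  have h1 := d.comb_mem_graph (fun p => 1 / d.bval p) c
  simp only [div_mul_cancel₀ _ (d.bval_ne_zero hk _)] at h1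
  have h2 : (x, d.comb 1 c) ∈ H.graph := mem_graph_iff_exists.mpr ⟨hxd, hc'.symm⟩
  exact eq_of_mem_graph_of_ker_eq_bot hk h1 h2

/-- The term with `u p` factors through the sum of `c'` over a class, the term with `u q` through
that of `c`; both sums vanish. -/
theorem matrixForm_zeroSum (u : d.Idx × ℕ → ℂ) {c c' : d.Idx × ℕ →₀ ℂ} (hc : c ∈ d.zeroSum)
    (hc' : c' ∈ d.zeroSum) :
    d.matrixForm (fun p q => if p.1 = q.1 then u p + u q else 0) c c' = 0 := by
  have h1 : d.matrixForm (fun p q => if p.1 = q.1 then u p + u q else 0) c c' =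
      ∑ p ∈ c.support, conj (c p) * u p * ∑ q ∈ c'.support, (if q.1 = p.1 then c' q else 0) +
      ∑ q ∈ c'.support, c' q * u q *
        conj (∑ p ∈ c.support, (if p.1 = q.1 then c p else 0)) := by
    simp only [Finset.mul_sum, map_sum]
    rw [Finset.sum_comm (s := c'.support), matrixForm, ← Finset.sum_add_distrib]
    refine Finset.sum_congr rfl fun p _ => ?_
    rw [← Finset.sum_add_distrib]
    refine Finset.sum_congr rfl fun q _ => ?_
    by_cases h : p.1 = q.1
    · simp only [h, if_true]; ring
    · rw [if_neg h, if_neg (fun h' => h h'.symm), if_neg h, map_zero]; ring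
  rw [h1]
  simp only [d.sum_eq_zero_of_mem_zeroSum hc, d.sum_eq_zero_of_mem_zeroSum hc', map_zero, mul_zero,
    Finset.sum_const_zero, add_zero]

/-- Off the diagonal, `1/F_p - 1/F_q = -(F_p - F_q)/(F_p F_q)` cancels the factor `F_p - F_q`. On
the diagonal `coeff` is `I / 0 = 0`, and the identity term supplies exactly the value `i` of the
right-hand side. -/
theorem bval_sub_mul_coeff (hk : LinearMap.ker H.toFun = ⊥) (p q : d.Idx × ℕ) :
    (d.bval p - d.bval q) * d.coeff p q + Complex.I * (if p = q then 1 else 0) =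
      if p.1 = q.1 then Complex.I / 2 * (d.bval p / d.bval q + d.bval q / d.bval p) else 0 := by
  have hp := d.bval_ne_zero hk p
  have hq := d.bval_ne_zero hk q
  by_cases h1 : p.1 = q.1
  · by_cases h2 : p = q
    · subst h2
      rw [if_pos rfl, if_pos rfl, div_self hp]
      ring
    · have hne : d.bval p - d.bval q ≠ 0 := by
        intro h
        apply h2
        refine Prod.ext h1 ?_
        have h3 : d.val p.1 p.2 = d.val q.1 q.2 := Complex.ofReal_injective (sub_eq_zero.mp h)
        rw [h1] at h3
        exact d.injective _ h3
      rw [if_neg h2, if_pos h1, coeff, if_pos h1]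
      have h4 : 1 / d.bval p - 1 / d.bval q = -(d.bval p - d.bval q) / (d.bval p * d.bval q) := by
        field_simp; ring
      rw [h4]
      field_simp
      ring
  · rw [if_neg h1, if_neg (fun h => h1 (congrArg Prod.fst h)), coeff, if_neg h1]
    ring

open Filter Topology in
-- Since `F_k → 0`, the vectors `F_n e_n - F_k e_k` of `H_p 𝓔_p` converge to `F_n e_n`, and `F_n ≠
-- 0`.
theorem ppSubspace_le_closure_mapCcrP (hk : LinearMap.ker H.toFun = ⊥) :
    ppSubspace H ≤ d.mapCcrP.topologicalClosure := by
  rw [← d.span_eq]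
  refine Submodule.topologicalClosure_minimal _ ?_ (Submodule.isClosed_topologicalClosure _)
  rw [Submodule.span_le]
  rintro _ ⟨⟨j, n⟩, rfl⟩
  have hmem : ∀ k, d.bval (j, n) • d.bvec (j, n) - d.bval (j, k) • d.bvec (j, k) ∈ d.mapCcrP := by
    intro k
    have h := H.graph.sub_mem (d.bvec_mem_graph (j, n)) (d.bvec_mem_graph (j, k))
    obtain ⟨h1, h2⟩ := mem_graph_iff_exists.mp h
    exact ⟨⟨_, h1⟩, d.sub_mem_ccrP j n k, h2⟩
  have hlim : Tendsto (fun k => d.bval (j, n) • d.bvec (j, n) - d.bval (j, k) • d.bvec (j, k))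
      atTop (𝓝 (d.bval (j, n) • d.bvec (j, n))) := by
    have h1 : Tendsto (fun k => d.bval (j, k) • d.bvec (j, k)) atTop (𝓝 0) := by
      rw [tendsto_zero_iff_norm_tendsto_zero]
      have h2 : ∀ k, ‖d.bval (j, k) • d.bvec (j, k)‖ = |d.val j k| := by
        intro k
        have h3 : ‖d.bvec (j, k)‖ = 1 := d.orthonormal.1 (j, k)
        rw [norm_smul, h3, mul_one, bval, Complex.norm_real, Real.norm_eq_abs]
      simp only [h2]
      exact (tendsto_zero_iff_abs_tendsto_zero _).mp (d.tendsto_val j)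
    simpa using h1.const_sub (d.bval (j, n) • d.bvec (j, n))
  have h1 : d.bval (j, n) • d.bvec (j, n) ∈ d.mapCcrP.topologicalClosure :=
    mem_closure_of_tendsto hlim (Eventually.of_forall hmem)
  have h2 := Submodule.smul_mem _ (d.bval (j, n))⁻¹ h1
  rwa [smul_smul, inv_mul_cancel₀ (d.bval_ne_zero hk _), one_smul] at h2

variable [CompleteSpace E]

theorem conj_formP (hk : LinearMap.ker H.toFun = ⊥) {φ ψ : E} (hφ : φ ∈ d.domP)
    (hψ : ψ ∈ d.domP) : conj (d.formP φ ψ) = d.formP ψ φ := by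
  obtain ⟨c, rfl⟩ := d.exists_comb_of_mem_domP hφ
  obtain ⟨c', rfl⟩ := d.exists_comb_of_mem_domP hψ
  rw [formP_comb d hk, formP_comb d hk, conj_matrixForm]
  simp [conj_coeff]

theorem formP_add_left (hk : LinearMap.ker H.toFun = ⊥) {φ φ' ψ : E} (hφ : φ ∈ d.domP)
    (hφ' : φ' ∈ d.domP) (hψ : ψ ∈ d.domP) :
    d.formP (φ + φ') ψ = d.formP φ ψ + d.formP φ' ψ := by
  obtain ⟨c, rfl⟩ := d.exists_comb_of_mem_domP hφ
  obtain ⟨c₁, rfl⟩ := d.exists_comb_of_mem_domP hφ'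
  obtain ⟨c', rfl⟩ := d.exists_comb_of_mem_domP hψ
  rw [← map_add]
  simp only [formP_comb d hk, matrixForm_add_left]

theorem formP_smul_left (hk : LinearMap.ker H.toFun = ⊥) (a : ℂ) {φ ψ : E} (hφ : φ ∈ d.domP)
    (hψ : ψ ∈ d.domP) : d.formP (a • φ) ψ = conj a * d.formP φ ψ := by
  obtain ⟨c, rfl⟩ := d.exists_comb_of_mem_domP hφ
  obtain ⟨c', rfl⟩ := d.exists_comb_of_mem_domP hψ
  rw [← map_smul]
  simp only [formP_comb d hk, matrixForm_smul_left]

theorem formP_add_right (hk : LinearMap.ker H.toFun = ⊥) {φ ψ ψ' : E} (hφ : φ ∈ d.domP)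
    (hψ : ψ ∈ d.domP) (hψ' : ψ' ∈ d.domP) :
    d.formP φ (ψ + ψ') = d.formP φ ψ + d.formP φ ψ' := by
  rw [← d.conj_formP hk (d.domP.add_mem hψ hψ') hφ, d.formP_add_left hk hψ hψ' hφ, map_add,
    d.conj_formP hk hψ hφ, d.conj_formP hk hψ' hφ]

theorem formP_smul_right (hk : LinearMap.ker H.toFun = ⊥) (a : ℂ) {φ ψ : E} (hφ : φ ∈ d.domP)
    (hψ : ψ ∈ d.domP) : d.formP φ (a • ψ) = a * d.formP φ ψ := by
  rw [← d.conj_formP hk (d.domP.smul_mem a hψ) hφ, d.formP_smul_left hk a hψ hφ, map_mul,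
    Complex.conj_conj, d.conj_formP hk hψ hφ]

/-- The ultra-weak canonical commutation relation, for vectors with real weights `w`. -/
theorem formP_ccr_comb (hk : LinearMap.ker H.toFun = ⊥) {w u : d.Idx × ℕ → ℂ}
    (hw : ∀ p, conj (w p) = w p)
    (hu : ∀ p q, w p * w q * (d.bval p / d.bval q + d.bval q / d.bval p) = u p + u q)
    {c c' : d.Idx × ℕ →₀ ℂ} (hc : c ∈ d.zeroSum) (hc' : c' ∈ d.zeroSum) :
    d.formP (d.comb (fun p => w p * d.bval p) c) (d.comb w c') -
      conj (d.formP (d.comb (fun p => w p * d.bval p) c') (d.comb w c)) =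
      -(Complex.I * inner ℂ (d.comb w c) (d.comb w c')) := by
  -- The difference of the two sides has the entries `w_p w_q` times those of `bval_sub_mul_coeff`;
  -- by `hu` these split as `(i/2)(u_p + u_q)` within a class.
  have h0 := d.matrixForm_zeroSum (fun p => Complex.I / 2 * u p) hc hc'
  rw [formP_comb d hk, formP_comb d hk, conj_matrixForm, inner_comb_comb, ← sub_eq_zero,
    sub_neg_eq_add]
  refine Eq.trans ?_ h0
  simp only [matrixForm, Finset.mul_sum, ← Finset.sum_add_distrib, ← Finset.sum_sub_distrib]
  refine Finset.sum_congr rfl fun p _ => Finset.sum_congr rfl fun q _ => ?_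
  have h1 := d.bval_sub_mul_coeff hk p q
  have h2 : (if p.1 = q.1 then Complex.I / 2 * u p + Complex.I / 2 * u q else 0) =
      w p * w q * (if p.1 = q.1 then
        Complex.I / 2 * (d.bval p / d.bval q + d.bval q / d.bval p) else 0) := by
    split_ifs
    · linear_combination -(Complex.I / 2) * hu p q
    · ring
  rw [h2, ← h1]
  simp only [map_mul, conj_coeff, conj_bval, hw]
  ring

/-- The weights `w = F` split: `F_p F_q (F_p/F_q + F_q/F_p) = F_p² + F_q²`. -/
theorem formP_ccr_mapCcrP (hk : LinearMap.ker H.toFun = ⊥) {φ ψ φ' ψ' : E}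
    (hφ : φ ∈ d.mapCcrP) (hψ : ψ ∈ d.mapCcrP) (hφ' : (φ, φ') ∈ H.graph)
    (hψ' : (ψ, ψ') ∈ H.graph) :
    d.formP φ' ψ - conj (d.formP ψ' φ) = -(Complex.I * inner ℂ φ ψ) := by
  obtain ⟨c, hc, rfl⟩ := d.exists_zeroSum_of_mem_mapCcrP hφ
  obtain ⟨c', hc', rfl⟩ := d.exists_zeroSum_of_mem_mapCcrP hψ
  have h1 : φ' = _ := LinearPMap.mem_graph_snd_inj' H hφ' (d.comb_mem_graph _ c) rfl
  have h2 : ψ' = _ := LinearPMap.mem_graph_snd_inj' H hψ' (d.comb_mem_graph _ c') rfl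
  rw [h1, h2]
  refine d.formP_ccr_comb hk (u := fun p => d.bval p ^ 2) (d.conj_bval) (fun p q => ?_) hc hc'
  have hp := d.bval_ne_zero hk p
  have hq := d.bval_ne_zero hk q
  field_simp

/-- The weights `w = 1/F` split as well, into `1/F_p² + 1/F_q²`. -/
theorem formP_ccr_invCcrP (hk : LinearMap.ker H.toFun = ⊥) {φ ψ φ' ψ' : E}
    (hφ : φ ∈ d.invCcrP) (hψ : ψ ∈ d.invCcrP) (hφ' : (φ, φ') ∈ H.graph)
    (hψ' : (ψ, ψ') ∈ H.graph) :
    d.formP φ' ψ - conj (d.formP ψ' φ) = -(Complex.I * inner ℂ φ ψ) := by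
  obtain ⟨c, hc, rfl⟩ := d.exists_zeroSum_of_mem_invCcrP hk hφ
  obtain ⟨c', hc', rfl⟩ := d.exists_zeroSum_of_mem_invCcrP hk hψ
  have h1 : φ' = _ := LinearPMap.mem_graph_snd_inj' H hφ' (d.comb_mem_graph _ c) rfl
  have h2 : ψ' = _ := LinearPMap.mem_graph_snd_inj' H hψ' (d.comb_mem_graph _ c') rfl
  rw [h1, h2]
  refine d.formP_ccr_comb hk (u := fun p => (1 / d.bval p) ^ 2) (fun p => ?_) (fun p q => ?_) hc hc'
  · rw [map_div₀, map_one, conj_bval]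
  have hp := d.bval_ne_zero hk p
  have hq := d.bval_ne_zero hk q
  field_simp
  ring

end EigenDecomposition

end PointCCR

/-! ### Assembling the form `t_H` from its two parts. -/

section MainForm

variable {E : Type*} [NormedAddCommGroup E] [InnerProductSpace ℂ E] {H : E →ₗ.[ℂ] E}

theorem EigenDecomposition.exists_mem_graph_of_mem_domP (d : EigenDecomposition H) {φ : E}
    (hφ : φ ∈ d.domP) : ∃ φ' ∈ d.domP, (φ, φ') ∈ H.graph := by
  obtain ⟨c, rfl⟩ := d.exists_comb_of_mem_domP hφ
  exact ⟨_, d.comb_mem_domP _ c, d.comb_mem_graph _ c⟩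

theorem EigenDecomposition.mapCcrP_le_domP (d : EigenDecomposition H) : d.mapCcrP ≤ d.domP := by
  intro x hx
  obtain ⟨c, -, rfl⟩ := d.exists_zeroSum_of_mem_mapCcrP hx
  exact d.comb_mem_domP _ c

theorem EigenDecomposition.invCcrP_le_domP (d : EigenDecomposition H)
    (hk : LinearMap.ker H.toFun = ⊥) : d.invCcrP ≤ d.domP := by
  intro x hx
  obtain ⟨c, -, rfl⟩ := d.exists_zeroSum_of_mem_invCcrP hk hx
  exact d.comb_mem_domP _ c

theorem mem_dirSum {A : Submodule ℂ (acSubspace H)} {B : Submodule ℂ E} {x : E} :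
    x ∈ dirSum A B ↔ ∃ a ∈ A, ∃ b ∈ B, x = (a : E) + b := by
  rw [dirSum, Submodule.mem_sup]
  constructor
  · rintro ⟨_, ⟨a, ha, rfl⟩, b, hb, rfl⟩
    exact ⟨a, ha, b, hb, rfl⟩
  · rintro ⟨a, ha, b, hb, rfl⟩
    exact ⟨_, ⟨a, ha, rfl⟩, b, hb, rfl⟩

theorem dirSum_ne_bot {A : Submodule ℂ (acSubspace H)} {B : Submodule ℂ E} (hA : A ≠ ⊥) :
    dirSum A B ≠ ⊥ := by
  obtain ⟨a, ha, ha0⟩ := Submodule.exists_mem_ne_zero_of_ne_bot hA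
  refine Submodule.ne_bot_iff _ |>.mpr ⟨(a : E), mem_dirSum.mpr ⟨a, ha, 0, B.zero_mem, by simp⟩, ?_⟩
  exact fun h => ha0 (Subtype.ext h)

theorem acPart_mem_graph {x : acSubspace H} (hx : x ∈ (acPart H).domain) :
    ((x : E), (acPart H ⟨x, hx⟩ : E)) ∈ H.graph :=
  mem_graph_iff_exists.mpr ⟨hx.choose, rfl⟩

theorem dense_dirSum_mapCcrP (hk : LinearMap.ker H.toFun = ⊥)
    (htop : acSubspace H ⊔ ppSubspace H = ⊤) {Dac : Submodule ℂ (acSubspace H)}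
    (hD : Dense (Dac : Set (acSubspace H))) (d : EigenDecomposition H) :
    Dense (dirSum Dac d.mapCcrP : Set E) := by
  rw [Submodule.dense_iff_topologicalClosure_eq_top, eq_top_iff, ← htop]
  refine sup_le ?_ ?_
  · intro x hx
    have h1 : (⟨x, hx⟩ : acSubspace H) ∈ closure (Dac : Set (acSubspace H)) := hD _
    refine map_mem_closure continuous_subtype_val h1 fun a ha => ?_
    exact mem_dirSum.mpr ⟨a, ha, 0, Submodule.zero_mem _, by simp⟩
  · exact (d.ppSubspace_le_closure_mapCcrP hk).trans
      (Submodule.topologicalClosure_mono le_sup_right)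

variable [CompleteSpace E]

theorem orthogonalProjectionOnto_acSubspace_add (hH : H.IsFormalAdjoint H) (a : acSubspace H)
    {b : E} (hb : b ∈ ppSubspace H) :
    (acSubspace H).orthogonalProjectionOnto ((a : E) + b) = a := by
  have hb' : b ∈ (acSubspace H)ᗮ := (acSubspace_isOrtho_ppSubspace hH).symm.le hb
  rw [map_add, Submodule.orthogonalProjectionOnto_mem_subspace_eq_self,
    Submodule.orthogonalProjectionOnto_eq_zero_iff.mpr hb', add_zero]

theorem starProjection_ppSubspace_add (hH : H.IsFormalAdjoint H) (a : acSubspace H)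
    {b : E} (hb : b ∈ ppSubspace H) :
    (ppSubspace H).starProjection ((a : E) + b) = b := by
  have ha' : (a : E) ∈ (ppSubspace H)ᗮ := (acSubspace_isOrtho_ppSubspace hH).le a.2
  rw [map_add, Submodule.starProjection_eq_self_iff.mpr hb,
    (Submodule.starProjection_apply_eq_zero_iff _).mpr ha', zero_add]

variable {T : acSubspace H →ₗ.[ℂ] acSubspace H}

/-- Orthogonality of the two subspaces makes the projections recover the components of any
decomposition, so the form does not depend on the one chosen. -/
theorem formH_apply (hH : H.IsFormalAdjoint H) (d : EigenDecomposition H)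
    (φ : dirSum (⊤ : Submodule ℂ (acSubspace H)) d.domP) (ψ : dirSum T.domain d.domP)
    (φ₁ : acSubspace H) (ψ₁ : T.domain) {φ₂ ψ₂ : E} (hφ₂ : φ₂ ∈ d.domP) (hψ₂ : ψ₂ ∈ d.domP)
    (hφ : (φ : E) = φ₁ + φ₂) (hψ : (ψ : E) = (ψ₁ : acSubspace H) + ψ₂) :
    formH T d φ ψ = inner ℂ φ₁ (T ψ₁) + d.formP φ₂ ψ₂ := by
  have h1 := d.domP_le_ppSubspace hφ₂
  have h2 := d.domP_le_ppSubspace hψ₂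
  rw [formH, hφ, hψ, orthogonalProjectionOnto_acSubspace_add hH _ h1,
    orthogonalProjectionOnto_acSubspace_add hH _ h2, starProjection_ppSubspace_add hH _ h1,
    starProjection_ppSubspace_add hH _ h2, value_of_mem ψ₁.2]

theorem isSesquilinear_formH (hH : H.IsFormalAdjoint H) (hk : LinearMap.ker H.toFun = ⊥)
    (d : EigenDecomposition H) : IsSesquilinear (formH T d) where
  add_left := by
    rintro ⟨φ, hφ⟩ ⟨φ', hφ'⟩ ⟨ψ, hψ⟩
    obtain ⟨a, -, b, hb, rfl⟩ := mem_dirSum.mp hφ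
    obtain ⟨a', -, b', hb', rfl⟩ := mem_dirSum.mp hφ'
    obtain ⟨x, hx, y, hy, rfl⟩ := mem_dirSum.mp hψ
    rw [formH_apply hH d _ _ (a + a') ⟨x, hx⟩ (d.domP.add_mem hb hb') hy
        (by simp only [Submodule.coe_add]; abel) rfl,
      formH_apply hH d _ _ a ⟨x, hx⟩ hb hy rfl rfl,
      formH_apply hH d _ _ a' ⟨x, hx⟩ hb' hy rfl rfl, inner_add_left,
      d.formP_add_left hk hb hb' hy]
    ring
  smul_left := by
    rintro c ⟨φ, hφ⟩ ⟨ψ, hψ⟩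
    obtain ⟨a, -, b, hb, rfl⟩ := mem_dirSum.mp hφ
    obtain ⟨x, hx, y, hy, rfl⟩ := mem_dirSum.mp hψ
    rw [formH_apply hH d _ _ (c • a) ⟨x, hx⟩ (d.domP.smul_mem c hb) hy
        (by simp only [Submodule.coe_smul, smul_add]) rfl,
      formH_apply hH d _ _ a ⟨x, hx⟩ hb hy rfl rfl, inner_smul_left,
      d.formP_smul_left hk c hb hy]
    ring
  add_right := by
    rintro ⟨φ, hφ⟩ ⟨ψ, hψ⟩ ⟨ψ', hψ'⟩
    obtain ⟨a, -, b, hb, rfl⟩ := mem_dirSum.mp hφ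
    obtain ⟨x, hx, y, hy, rfl⟩ := mem_dirSum.mp hψ
    obtain ⟨x', hx', y', hy', rfl⟩ := mem_dirSum.mp hψ'
    rw [formH_apply hH d _ _ a (⟨x, hx⟩ + ⟨x', hx'⟩) hb (d.domP.add_mem hy hy') rfl
        (by simp only [Submodule.coe_add]; abel),
      formH_apply hH d _ _ a ⟨x, hx⟩ hb hy rfl rfl,
      formH_apply hH d _ _ a ⟨x', hx'⟩ hb hy' rfl rfl, LinearPMap.map_add, inner_add_right,
      d.formP_add_right hk hb hy hy']
    ring
  smul_right := by
    rintro c ⟨φ, hφ⟩ ⟨ψ, hψ⟩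
    obtain ⟨a, -, b, hb, rfl⟩ := mem_dirSum.mp hφ
    obtain ⟨x, hx, y, hy, rfl⟩ := mem_dirSum.mp hψ
    rw [formH_apply hH d _ _ a (c • ⟨x, hx⟩) hb (d.domP.smul_mem c hy) rfl
        (by simp only [Submodule.coe_smul, smul_add]),
      formH_apply hH d _ _ a ⟨x, hx⟩ hb hy rfl rfl, LinearPMap.map_smul, inner_smul_right,
      d.formP_smul_right hk c hb hy]
    ring

/-- Both `H` and the form respect the orthogonal sum, so the commutation relation may be checked on
each part. The subspace `B` stands for either `H_p⁻¹ 𝓔_p` or `H_p 𝓔_p`; the symmetric domain is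
`D(T) ⊕ D_p`. -/
theorem isUltraWeakCCRDomain_dirSum (hH : H.IsFormalAdjoint H) (hk : LinearMap.ker H.toFun = ⊥)
    (hT : T.IsFormalAdjoint T) {Dac : Submodule ℂ (acSubspace H)}
    (hD : IsCCRDomain (acPart H) T Dac) (d : EigenDecomposition H) {B : Submodule ℂ E}
    (hB : B ≤ d.domP)
    (hccr : ∀ {φ ψ φ' ψ' : E}, φ ∈ B → ψ ∈ B → (φ, φ') ∈ H.graph → (ψ, ψ') ∈ H.graph →
      d.formP φ' ψ - conj (d.formP ψ' φ) = -(Complex.I * inner ℂ φ ψ)) :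
    IsUltraWeakCCRDomain H (formH T d) (dirSum Dac B) := by
  have hDT : Dac ≤ T.domain := fun x hx => (hD.2 x hx).choose_spec.choose
  have hle : dirSum Dac B ≤ dirSum T.domain d.domP :=
    sup_le_sup (Submodule.map_mono hDT) hB
  have hle' : dirSum T.domain d.domP ≤ dirSum ⊤ d.domP :=
    sup_le_sup (Submodule.map_mono le_top) le_rfl
  have hgraph : ∀ φ ∈ dirSum Dac B, ∃ a, ∃ (_ : a ∈ Dac) (ha : a ∈ (acPart H).domain), ∃ b ∈ B,
      ∃ b' ∈ d.domP, (b, b') ∈ H.graph ∧ φ = a + b ∧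
        (φ, (acPart H ⟨a, ha⟩ : E) + b') ∈ H.graph := by
    intro φ hφ
    obtain ⟨a, ha, b, hb, rfl⟩ := mem_dirSum.mp hφ
    obtain ⟨haA, -⟩ := hD.2 a ha
    obtain ⟨b', hb', hbb'⟩ := d.exists_mem_graph_of_mem_domP (hB hb)
    exact ⟨a, ha, haA, b, hb, b', hb', hbb', rfl,
      H.graph.add_mem (acPart_mem_graph haA) hbb'⟩
  have hdom : dirSum Dac B ≤ H.domain := by
    intro φ hφ
    obtain ⟨a, -, ha, b, -, b', -, -, -, h⟩ := hgraph φ hφ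
    exact (mem_graph_iff_exists.mp h).choose
  refine ⟨dirSum T.domain d.domP, ?_⟩
  have hmap : ∀ φ (hφ : φ ∈ dirSum Dac B), H ⟨φ, hdom hφ⟩ ∈
      dirSum (⊤ : Submodule ℂ (acSubspace H)) d.domP := by
    intro φ hφ
    obtain ⟨a, -, ha, b, -, b', hb', -, -, h⟩ := hgraph φ hφ
    rw [(mem_graph_iff_exists.mp h).choose_spec]
    exact mem_dirSum.mpr ⟨_, Submodule.mem_top, b', hb', rfl⟩
  refine
    { ne_bot := dirSum_ne_bot hD.1
      symm_ne_bot := dirSum_ne_bot fun h => hD.1 (le_bot_iff.mp (h ▸ hDT))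
      symm_le_left := hle'
      symm_le_right := le_rfl
      le_symm := hle
      le_domain := hdom
      map_mem := hmap
      symm := ?_
      ccr := ?_ }
  · intro φ ψ hφ hψ
    obtain ⟨a, ha, b, hb, rfl⟩ := mem_dirSum.mp hφ
    obtain ⟨x, hx, y, hy, rfl⟩ := mem_dirSum.mp hψ
    rw [formH_apply hH d _ _ a ⟨x, hx⟩ hb hy rfl rfl,
      formH_apply hH d _ _ x ⟨a, ha⟩ hy hb rfl rfl, map_add, d.conj_formP hk hb hy,
      inner_conj_symm]
    congr 1
    exact hT ⟨x, hx⟩ ⟨a, ha⟩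
  · intro φ ψ hφ hψ
    obtain ⟨a, ha, haA, b, hb, b', hb', hbb', rfl, h1⟩ := hgraph φ hφ
    obtain ⟨x, hx, hxA, y, hy, y', hy', hyy', rfl, h2⟩ := hgraph ψ hψ
    obtain ⟨hA, hT', hAT, hTA, hcomm⟩ := hD.2 x hx
    have haT := hDT ha
    rw [formH_apply hH d _ _ (acPart H ⟨a, haA⟩) ⟨x, hT'⟩ hb' (hB hy)
        (mem_graph_iff_exists.mp h1).choose_spec rfl,
      formH_apply hH d _ _ (acPart H ⟨x, hxA⟩) ⟨a, haT⟩ hy' (hB hb)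
        (mem_graph_iff_exists.mp h2).choose_spec rfl]
    -- Symmetry of `H_ac` and of `T` moves both operators to the right, giving `(a, (H_ac T - T
    -- H_ac)x)`.
    have e1 : inner ℂ (acPart H ⟨a, haA⟩) (T ⟨x, hT'⟩) - conj (inner ℂ (acPart H ⟨x, hxA⟩)
        (T ⟨a, haT⟩)) = -(Complex.I * inner ℂ a x) := by
      rw [inner_conj_symm, reducedPart_isFormalAdjoint hH _ ⟨a, haA⟩ ⟨_, hAT⟩,
        hT ⟨a, haT⟩ ⟨_, hTA⟩, ← inner_sub_right, hcomm, inner_neg_right, inner_smul_right]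
    have e2 := hccr hb hy hbb' hyy'
    have ho := acSubspace_isOrtho_ppSubspace hH
    have e3 : inner ℂ ((a : E) + b) ((x : E) + y) = inner ℂ a x + inner ℂ b y := by
      rw [inner_add_left, inner_add_right, inner_add_right,
        ho.inner_eq a.2 (d.domP_le_ppSubspace (hB hy)),
        ho.symm.inner_eq (d.domP_le_ppSubspace (hB hb)) x.2, Submodule.coe_inner]
      ring
    rw [e3, map_add]
    linear_combination e1 + e2

/-- All eigenvalues are negative, so `0` is not one of them. This is what makes `H⁻¹` and the
numbers `1/F_{jn}` meaningful. -/
theorem ClassS1.ker_eq_bot (hH : ClassS1 H) : LinearMap.ker H.toFun = ⊥ := by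
  obtain ⟨e, he, -, hneg, -⟩ := hH.point_eq
  rw [Submodule.eq_bot_iff]
  intro x hx
  have h1 : (x : E) ∈ eigenspace H 0 :=
    mem_eigenspace_iff.mpr ⟨x.2, by rw [zero_smul]; exact hx⟩
  have h2 : (0 : ℂ) ∉ pointSpectrum H := by
    rw [he]
    rintro ⟨n, hn⟩
    exact (hneg n).ne (Complex.ofReal_eq_zero.mp hn)
  have h3 : eigenspace H 0 = ⊥ := by
    by_contra h
    exact h2 h
  rw [h3, Submodule.mem_bot] at h1
  exact Subtype.ext h1

theorem ClassS1.nonempty_eigenDecomposition (hH : ClassS1 H) :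
    Nonempty (EigenDecomposition H) := by
  obtain ⟨e, he, hmono, -, hlim⟩ := hH.point_eq
  refine TimeOperator.nonempty_eigenDecomposition
    (isFormalAdjoint_of_isSelfAdjoint hH.selfAdjoint) he hmono.injective hlim fun n => ?_
  have h : (e n : ℂ) ∈ discreteSpectrum H := by
    rw [hH.disc_eq, he]; exact ⟨n, rfl⟩
  exact h.2.1

theorem ClassS1.acSubspace_sup_ppSubspace (hH : ClassS1 H) :
    acSubspace H ⊔ ppSubspace H = ⊤ := by
  have h := acSubspace_sup_scSubspace_sup_ppSubspace hH.selfAdjoint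
  rwa [scSubspace_eq_bot (isFormalAdjoint_of_isSelfAdjoint hH.selfAdjoint) hH.sc_empty,
    sup_bot_eq] at h

/-- On the zero space every number is in the resolvent set, whereas `σ(H_ac)` contains `0`. Hence a
dense CCR-domain is not the zero subspace. -/
theorem ClassS1.nontrivial_acSubspace (hH : ClassS1 H) : Nontrivial (acSubspace H) := by
  apply nontrivial_of_spectrum_nonempty (A := acPart H)
  rw [hH.ac_eq]
  exact ⟨_, 0, Set.self_mem_Ici, rfl⟩

end MainForm

end TimeOperator

end

/-! ### The theorem. -/

theorem theorem5 {ℋ : Type*} [NormedAddCommGroup ℋ] [InnerProductSpace ℂ ℋ] [CompleteSpace ℋ]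
    (H : ℋ →ₗ.[ℂ] ℋ) (hH : TimeOperator.ClassS1 H) :
    -- the objects from which the form is built exist
    (∃ T : TimeOperator.acSubspace H →ₗ.[ℂ] TimeOperator.acSubspace H,
      TimeOperator.IsStrongTimeOperator (TimeOperator.acPart H) T ∧ T.IsClosed) ∧
    (∀ T : TimeOperator.acSubspace H →ₗ.[ℂ] TimeOperator.acSubspace H,
      TimeOperator.IsStrongTimeOperator (TimeOperator.acPart H) T → T.IsClosed →
      ∃ Dac : Submodule ℂ (TimeOperator.acSubspace H),
        TimeOperator.IsCCRDomain (TimeOperator.acPart H) T Dac ∧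
        Dense (Dac : Set (TimeOperator.acSubspace H))) ∧
    Nonempty (TimeOperator.EigenDecomposition H) ∧
    -- and for every choice of them
    (∀ T : TimeOperator.acSubspace H →ₗ.[ℂ] TimeOperator.acSubspace H,
      TimeOperator.IsStrongTimeOperator (TimeOperator.acPart H) T →
      ∀ Dac : Submodule ℂ (TimeOperator.acSubspace H),
        TimeOperator.IsCCRDomain (TimeOperator.acPart H) T Dac →
        Dense (Dac : Set (TimeOperator.acSubspace H)) →
      ∀ d : TimeOperator.EigenDecomposition H,
        -- `t_H[φ₁ + φ₂, ψ₁ + ψ₂] = (φ₁, T ψ₁) + t_p[φ₂, ψ₂]`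
        (∀ (φ : TimeOperator.dirSum ⊤ d.domP) (ψ : TimeOperator.dirSum T.domain d.domP)
            (φ₁ : TimeOperator.acSubspace H) (ψ₁ : T.domain) (φ₂ ψ₂ : d.domP),
          (φ : ℋ) = (φ₁ : ℋ) + (φ₂ : ℋ) →
          (ψ : ℋ) = ((ψ₁ : TimeOperator.acSubspace H) : ℋ) + (ψ₂ : ℋ) →
          TimeOperator.formH T d φ ψ = inner ℂ φ₁ (T ψ₁) + d.formP φ₂ ψ₂) ∧
        TimeOperator.IsUltraWeakTimeOperator H (TimeOperator.formH T d) ∧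
        TimeOperator.IsUltraWeakCCRDomain H (TimeOperator.formH T d)
          (TimeOperator.dirSum Dac d.invCcrP) ∧
        TimeOperator.IsUltraWeakCCRDomain H (TimeOperator.formH T d)
          (TimeOperator.dirSum Dac d.mapCcrP) ∧
        Dense (TimeOperator.dirSum Dac d.mapCcrP : Set ℋ)) := by
  have hs := TimeOperator.isFormalAdjoint_of_isSelfAdjoint hH.selfAdjoint
  have hk := hH.ker_eq_bot
  have := hH.nontrivial_acSubspace
  refine ⟨?_, fun T hT hcl => hT.exists_dense_isCCRDomain hcl, hH.nonempty_eigenDecomposition, ?_⟩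
  · obtain ⟨T, hT⟩ := hH.exists_time
    exact ⟨T.closure, hT.closure, hT.2.1.isClosable.closure_isClosed⟩
  · intro T hT Dac hD hdense d
    have hinv := TimeOperator.isUltraWeakCCRDomain_dirSum hs hk hT.2.1.2 hD d
      (d.invCcrP_le_domP hk) (d.formP_ccr_invCcrP hk)
    have hmap := TimeOperator.isUltraWeakCCRDomain_dirSum hs hk hT.2.1.2 hD d
      d.mapCcrP_le_domP (d.formP_ccr_mapCcrP hk)
    refine ⟨fun φ ψ φ₁ ψ₁ φ₂ ψ₂ hφ hψ =>
      TimeOperator.formH_apply hs d φ ψ φ₁ ψ₁ φ₂.2 ψ₂.2 hφ hψ, ⟨?_, ?_,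
        TimeOperator.isSesquilinear_formH hs hk d, _, hmap⟩, hinv, hmap,
      TimeOperator.dense_dirSum_mapCcrP hk hH.acSubspace_sup_ppSubspace hdense d⟩
    · exact TimeOperator.dirSum_ne_bot top_ne_bot
    · refine TimeOperator.dirSum_ne_bot fun h => hD.1 (le_bot_iff.mp (h ▸ fun x hx => ?_))
      exact (hD.2 x hx).choose_spec.choose
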